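/- Let $k$ be an algebraically closed field of characteristic zero and let $i\in k$ with $i^2=-1$. Let $H_4$ be Sweedler's Hopf algebra over $k$: generated by $G,X$ with $G^2=1$, $X^2=0$, $XG=-GX$, and $\Delta(G)=G\otimes G$, $\varepsilon(G)=1$, $S(G)=G$, $\Delta(X)=X\otimes G+1\otimes X$, $\varepsilon(X)=0$, $S(X)=GX$. Let $H_8$ be the Kac–Paljutkin Hopf algebra over $k$: generated by $g,h,z$ with $$g^2=h^2=1,\quad gh=hg,\quad z^2=\tfrac12(1+g+h-gh),\quad gz=zh,\quad hz=zg,$$ where $g,h$ are group-like, $\Delta(z)=J(z\otimes z)$ with $J=\tfrac12(1\otimes1+g\otimes1+1\otimes h-g\otimes h)$, $\varepsilon(z)=1$, and $S(g)=g$, $S(h)=h$, $S(z)=z$. Let $H_{32,1},H_{32,2},H_{32,3}$ be the Hopf algebras generated by $g,h,z,G,X$ with the relations of $H_8$ for $g,h,z$, the relations of $H_4$ for $G,X$, the values of $\Delta,\varepsilon,S$ on the generators being those given above, and with the following further relations: - for $H_{32,1}$: $gG=Gg$, $hG=Gh$, $zG=Gz$, $gX=Xg$, $hX=Xh$, $zX=-Xz$;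 - for $H_{32,2}$: $gG=Gg$, $hG=Gh$, $gzG=Ghz$, $gX=-Xg$, $hX=-Xh$, $zX=i\,Xgz$; - for $H_{32,3}$: $gG=Gg$, $hG=Gh$, $gzG=Ghz$, $gX=-Xg$, $hX=-Xh$, $zX=-i\,Xgz$. A Hopf algebra $E$ *factorizes through* Hopf algebras $A$ and $H$ if there are injective Hopf algebra maps $\iota:A\to E$ and $\jmath:H\to E$ such that $A\otimes H\to E$, $a\otimes h\mapsto \iota(a)\jmath(h)$, is bijective. A *matched pair* $(A,H,\triangleright,\triangleleft)$ consists of Hopf algebras $A,H$ and coalgebra maps $\triangleright:H\otimes A\to A$, $\triangleleft:H\otimes A\to H$ making $A$ a left $H$-module coalgebra and $H$ a right $A$-module coalgebra, such that for all $a,b\in A$ and $x,y\in H$ (with Sweedler's notation $\Delta(c)=c_1\otimes c_2$, sums understood) $$x\triangleright 1=\varepsilon(x)1,\qquad 1\triangleleft a=\varepsilon(a)1,\qquad x\triangleright(ab)=(x_1\triangleright a_1)\big((x_2\triangleleft a_2)\triangleright b\big),$$ $$(yx)\triangleleft a=\big(y\triangleleft(x_1\triangleright a_1)\big)(x_2\triangleleft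 a_2),\qquad x_1\triangleleft a_1\otimes x_2\triangleright a_2=x_2\triangleleft a_2\otimes x_1\triangleright a_1 .$$ The corresponding *bicrossed product* $A\bowtie H$ is the tensor product coalgebra $A\otimes H$ with unit $1\otimes 1$ and product $(a\otimes x)(b\otimes y)=a(x_1\triangleright b_1)\otimes(x_2\triangleleft b_2)y$. **Theorem.** For a Hopf algebra $E$ over $k$ the following are equivalent: 1. $E$ factorizes through $H_8$ and $H_4$; 2. $E$ factorizes through $H_4$ and $H_8$ (in this order); 3. $E$ is isomorphic to a bicrossed product $H_8\bowtie H_4$, for some matched pair; 4. $E$ is isomorphic to a bicrossed product $H_4\bowtie H_8$, for some matched pair; 5. $E$ is isomorphic, as a Hopf algebra, to one of $H_8\otimes H_4$, $H_{32,1}$, $H_{32,2}$, $H_{32,3}$. -/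

import Mathlib

open scoped TensorProduct

noncomputable section

/-! ## Hopf algebra structures on an algebra with given generators -/

namespace HopfGen

section

variable {k : Type*} [Field k] {P : Type*} [Ring P] [Algebra k P]

/-- An algebra map `P → Pᵐᵒᵖ`, seen as a linear endomorphism of `P`. -/
def anti (S : P →ₐ[k] Pᵐᵒᵖ) : P →ₗ[k] P :=
  (MulOpposite.opLinearEquiv k).symm.toLinearMap ∘ₗ S.toLinearMap

@[simp] theorem anti_apply (S : P →ₐ[k] Pᵐᵒᵖ) (x : P) : anti S x = (S x).unop := rfl

/-- If `S` is an anti-homomorphism, the antipode identity `m (S ⊗ id) Δ = ε` is compatible with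
multiplication. -/
theorem left_mul (S : P →ₐ[k] Pᵐᵒᵖ) (u t : P ⊗[k] P) (c : k)
    (hu : LinearMap.mul' k P
      (((anti S).rTensor P) u)
        = algebraMap k P c) :
    LinearMap.mul' k P
      (((anti S).rTensor P) (u * t))
      = c • LinearMap.mul' k P
      (((anti S).rTensor P) t) := by
  induction t with
  | zero => simp
  | add x y hx hy => rw [mul_add, map_add, map_add, hx, hy, map_add, map_add, smul_add]
  | tmul a b =>
    have key : ∀ v : P ⊗[k] P, LinearMap.mul' k P
        (((anti S).rTensor P)
          (v * (a ⊗ₜ[k] b)))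
        = (S a).unop * LinearMap.mul' k P
        (((anti S).rTensor P) v) * b := by
      intro v
      induction v with
      | zero => simp
      | add x y hx hy =>
        rw [add_mul, map_add, map_add, hx, hy, map_add, map_add, mul_add, add_mul]
      | tmul x y => simp [mul_assoc]
    rw [key, hu]
    simp [Algebra.algebraMap_eq_smul_one]

/-- If `S` is an anti-homomorphism, the antipode identity `m (id ⊗ S) Δ = ε` is compatible with
multiplication. -/
theorem right_mul (S : P →ₐ[k] Pᵐᵒᵖ) (u t : P ⊗[k] P) (c : k)
    (ht : LinearMap.mul' k P
      (((anti S).lTensor P) t)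
        = algebraMap k P c) :
    LinearMap.mul' k P
      (((anti S).lTensor P) (u * t))
      = c • LinearMap.mul' k P
      (((anti S).lTensor P) u) := by
  induction u with
  | zero => simp
  | add x y hx hy => rw [add_mul, map_add, map_add, hx, hy, map_add, map_add, smul_add]
  | tmul a b =>
    have key : ∀ v : P ⊗[k] P, LinearMap.mul' k P
        (((anti S).lTensor P)
          ((a ⊗ₜ[k] b) * v))
        = a * LinearMap.mul' k P
        (((anti S).lTensor P) v)
          * (S b).unop := by
      intro v
      induction v with
      | zero => simp
      | add x y hx hy =>
        rw [mul_add, map_add, map_add, hx, hy, map_add, map_add, mul_add, add_mul]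
      | tmul x y => simp [mul_assoc]
    rw [key, ht]
    simp [Algebra.algebraMap_eq_smul_one]

/-- Two algebra maps that agree on generators are equal. -/
theorem ext_gen {B : Type*} [Ring B] [Algebra k B] {s : Set P} (hs : Algebra.adjoin k s = ⊤)
    {φ ψ : P →ₐ[k] B} (h : ∀ x ∈ s, φ x = ψ x) : φ = ψ :=
  AlgHom.ext_of_adjoin_eq_top hs h

/-- The Hopf algebra structure on an algebra `P` generated by `s` whose comultiplication `Δ` and
counit `ε` are algebra maps and whose antipode `S` is an anti-homomorphism; the axioms need to be
checked on the generators only. -/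
@[reducible] def mk (s : Set P) (hs : Algebra.adjoin k s = ⊤)
    (Δ : P →ₐ[k] P ⊗[k] P) (ε : P →ₐ[k] k) (S : P →ₐ[k] Pᵐᵒᵖ)
    (coassoc : ∀ x ∈ s, Algebra.TensorProduct.assoc k k k P P P
      (Algebra.TensorProduct.map Δ (.id k P) (Δ x))
        = Algebra.TensorProduct.map (.id k P) Δ (Δ x))
    (rT : ∀ x ∈ s, Algebra.TensorProduct.map ε (.id k P) (Δ x) = 1 ⊗ₜ x)
    (lT : ∀ x ∈ s, Algebra.TensorProduct.map (.id k P) ε (Δ x) = x ⊗ₜ 1)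
    (rS : ∀ x ∈ s, LinearMap.mul' k P
      (((anti S).rTensor P) (Δ x))
        = algebraMap k P (ε x))
    (lS : ∀ x ∈ s, LinearMap.mul' k P
      (((anti S).lTensor P) (Δ x))
        = algebraMap k P (ε x)) :
    HopfAlgebra k P :=
  letI B : Bialgebra k P := Bialgebra.ofAlgHom Δ ε
    (ext_gen hs coassoc) (ext_gen hs rT) (ext_gen hs lT)
  { B with
    antipode := anti S
    mul_antipode_rTensor_comul := by
      ext x
      change LinearMap.mul' k P (((anti S).rTensor P) (Δ x)) = algebraMap k P (ε x)
      have hx : x ∈ Algebra.adjoin k s := hs ▸ Algebra.mem_top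
      induction hx using Algebra.adjoin_induction with
      | mem x hx => exact rS x hx
      | algebraMap r => simp [Algebra.TensorProduct.one_def, Algebra.algebraMap_eq_smul_one]
      | add x y _ _ hx hy => rw [map_add, map_add, map_add, hx, hy, map_add, map_add]
      | mul x y _ _ hx hy =>
        rw [map_mul, left_mul S _ _ _ hx, hy, map_mul, map_mul, Algebra.smul_def]
    mul_antipode_lTensor_comul := by
      ext x
      change LinearMap.mul' k P (((anti S).lTensor P) (Δ x)) = algebraMap k P (ε x)
      have hx : x ∈ Algebra.adjoin k s := hs ▸ Algebra.mem_top
      induction hx using Algebra.adjoin_induction with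
      | mem x hx => exact lS x hx
      | algebraMap r => simp [Algebra.TensorProduct.one_def, Algebra.algebraMap_eq_smul_one]
      | add x y _ _ hx hy => rw [map_add, map_add, map_add, hx, hy, map_add, map_add]
      | mul x y _ _ hx hy =>
        rw [map_mul, right_mul S _ _ _ hy, hx, map_mul, map_mul, Algebra.smul_def, Algebra.commutes] }

/-- The generators of an algebra given by generators and relations generate it. -/
theorem adjoin_ringQuot {gen : Type*} (r : FreeAlgebra k gen → FreeAlgebra k gen → Prop) :
    Algebra.adjoin k (Set.range fun x => RingQuot.mkAlgHom k r (FreeAlgebra.ι k x)) = ⊤ := by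
  have h : (Set.range fun x => RingQuot.mkAlgHom k r (FreeAlgebra.ι k x))
      = RingQuot.mkAlgHom k r '' Set.range (FreeAlgebra.ι k (X := gen)) := by
    rw [← Set.range_comp]; rfl
  rw [h, ← AlgHom.map_adjoin, FreeAlgebra.adjoin_range_ι, Algebra.map_top,
    AlgHom.range_eq_top]
  exact RingQuot.mkAlgHom_surjective k r

end

end HopfGen

namespace HopfGen

section

variable (k : Type*) [Field k] {B : Type*} [Ring B] [Algebra k B]

/-- The defining relations of the Sweedler algebra. -/
structure Rel4 (G X : B) : Prop where
  GG : G * G = 1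
  XX : X * X = 0
  XG : X * G = -(G * X)

/-- The defining relations of the Kac-Paljutkin algebra. -/
structure Rel8 (g h z : B) : Prop where
  gg : g * g = 1
  hh : h * h = 1
  gh : g * h = h * g
  zz : z * z = (1 / 2 : k) • (1 + g + h - g * h)
  gz : g * z = z * h
  hz : h * z = z * g

/-- The element `J (z ⊗ z)` with `J = (1/2) (1 ⊗ 1 + g ⊗ 1 + 1 ⊗ h - g ⊗ h)`. -/
def comulZ (g h z : B) : B ⊗[k] B :=
  ((1 / 2 : k) • ((1 : B) ⊗ₜ[k] (1 : B) + g ⊗ₜ[k] (1 : B) + (1 : B) ⊗ₜ[k] h - g ⊗ₜ[k] h))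
    * (z ⊗ₜ[k] z)

/-- The element `X ⊗ G + 1 ⊗ X`. -/
def comulX (G X : B) : B ⊗[k] B := X ⊗ₜ[k] G + (1 : B) ⊗ₜ[k] X

variable {k}

theorem Rel4.comul {G X : B} (R : Rel4 G X) :
    Rel4 (G ⊗ₜ[k] G : B ⊗[k] B) (comulX k G X) := by
  obtain ⟨GG, XX, XG⟩ := R
  constructor <;>
  (simp [comulX, mul_add, add_mul, GG, XX, XG, Algebra.TensorProduct.one_def,
    TensorProduct.neg_tmul, TensorProduct.tmul_neg]; try abel)

theorem Rel4.op {G X : B} (R : Rel4 G X) :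
    Rel4 (MulOpposite.op G) (MulOpposite.op (G * X)) := by
  obtain ⟨GG, XX, XG⟩ := R
  constructor <;> simp only [← MulOpposite.op_mul, ← MulOpposite.op_one, ← MulOpposite.op_neg,
    ← MulOpposite.op_zero, MulOpposite.op_inj]
  · exact GG
  · rw [mul_assoc, ← mul_assoc X, XG, neg_mul, mul_assoc, XX]; simp
  · rw [mul_assoc, XG]; simp

theorem Rel8.comul [CharZero k] {g h z : B} (R : Rel8 k g h z) :
    Rel8 k (g ⊗ₜ[k] g : B ⊗[k] B) (h ⊗ₜ[k] h) (comulZ k g h z) := by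
  obtain ⟨gg, hh, gh, zz, gz, hz⟩ := R
  have gg2 : ∀ a, g * (g * a) = a := fun a => by rw [← mul_assoc, gg, one_mul]
  have hh2 : ∀ a, h * (h * a) = a := fun a => by rw [← mul_assoc, hh, one_mul]
  have hg2 : ∀ a, h * (g * a) = g * (h * a) := fun a => by rw [← mul_assoc, ← gh, mul_assoc]
  have zg2 : ∀ a, z * (g * a) = h * (z * a) := fun a => by rw [← mul_assoc, ← hz, mul_assoc]
  have zh2 : ∀ a, z * (h * a) = g * (z * a) := fun a => by rw [← mul_assoc, ← gz, mul_assoc]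
  constructor <;>
  simp [comulZ, mul_add, add_mul, mul_sub, sub_mul, gg, hh, ← gh, zz, ← gz, ← hz,
    gg2, hh2, hg2, zg2, zh2, mul_assoc, Algebra.TensorProduct.one_def,
    TensorProduct.add_tmul, TensorProduct.tmul_add,
    TensorProduct.sub_tmul, TensorProduct.tmul_sub, smul_add, smul_sub,
    ← TensorProduct.smul_tmul'] <;>
  module

theorem Rel8.op {g h z : B} (R : Rel8 k g h z) :
    Rel8 k (MulOpposite.op g) (MulOpposite.op h) (MulOpposite.op z) := by
  obtain ⟨gg, hh, gh, zz, gz, hz⟩ := R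
  constructor <;> simp only [← MulOpposite.op_mul, ← MulOpposite.op_one, ← MulOpposite.op_add,
    ← MulOpposite.op_sub, ← MulOpposite.op_smul, MulOpposite.op_inj]
  · exact gg
  · exact hh
  · exact gh.symm
  · rw [zz, gh]
  · exact hz.symm
  · exact gz.symm

end

end HopfGen

namespace HopfGen

section

variable (k : Type*) [Field k] {B : Type*} [Ring B] [Algebra k B]

/-- The cross relations of the first 32-dimensional algebra. -/
structure RelA (g h z G X : B) : Prop where
  gG : g * G = G * g
  hG : h * G = G * h
  zG : z * G = G * z
  gX : g * X = X * g
  hX : h * X = X * h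
  zX : z * X = -(X * z)

/-- The cross relations of the other two 32-dimensional algebras. -/
structure RelB (q : k) (g h z G X : B) : Prop where
  gG : g * G = G * g
  hG : h * G = G * h
  gzG : g * z * G = G * h * z
  gX : g * X = -(X * g)
  hX : h * X = -(X * h)
  zX : z * X = q • (X * g * z)

variable {k}

theorem RelA.comul {g h z G X : B} (R : RelA g h z G X) :
    RelA (g ⊗ₜ[k] g : B ⊗[k] B) (h ⊗ₜ[k] h) (comulZ k g h z) (G ⊗ₜ[k] G) (comulX k G X) := by
  obtain ⟨gG, hG, zG, gX, hX, zX⟩ := R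
  have gG2 : ∀ a, g * (G * a) = G * (g * a) := fun a => by rw [← mul_assoc, gG, mul_assoc]
  have hG2 : ∀ a, h * (G * a) = G * (h * a) := fun a => by rw [← mul_assoc, hG, mul_assoc]
  have zG2 : ∀ a, z * (G * a) = G * (z * a) := fun a => by rw [← mul_assoc, zG, mul_assoc]
  have gX2 : ∀ a, g * (X * a) = X * (g * a) := fun a => by rw [← mul_assoc, gX, mul_assoc]
  have hX2 : ∀ a, h * (X * a) = X * (h * a) := fun a => by rw [← mul_assoc, hX, mul_assoc]
  have zX2 : ∀ a, z * (X * a) = -(X * (z * a)) :=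
    fun a => by rw [← mul_assoc, zX, neg_mul, mul_assoc]
  constructor <;>
  simp [comulZ, comulX, mul_add, add_mul, mul_sub, sub_mul, gG, hG, zG, gX, hX, zX,
    gG2, hG2, zG2, gX2, hX2, zX2, mul_assoc, smul_add, smul_sub, TensorProduct.neg_tmul,
    TensorProduct.tmul_neg, ← TensorProduct.smul_tmul'] <;>
  module

theorem RelA.op {g h z G X : B} (R : RelA g h z G X) :
    RelA (MulOpposite.op g) (MulOpposite.op h) (MulOpposite.op z) (MulOpposite.op G)
      (MulOpposite.op (G * X)) := by
  obtain ⟨gG, hG, zG, gX, hX, zX⟩ := R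
  constructor <;> simp only [← MulOpposite.op_mul, ← MulOpposite.op_neg, MulOpposite.op_inj]
  · exact gG.symm
  · exact hG.symm
  · exact zG.symm
  · rw [mul_assoc, ← gX, ← mul_assoc, ← gG, mul_assoc]
  · rw [mul_assoc, ← hX, ← mul_assoc, ← hG, mul_assoc]
  · rw [← mul_assoc, zG, mul_assoc G z X, zX, mul_neg, neg_neg, mul_assoc]

theorem RelB.zG {q : k} {g h z G X : B} (R8 : Rel8 k g h z) (R : RelB k q g h z G X) :
    z * G = G * (g * (h * z)) := by
  have := congrArg (g * ·) R.gzG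
  simp only [mul_assoc] at this
  rw [← mul_assoc g g, R8.gg, one_mul, ← mul_assoc g G, R.gG] at this
  rw [this, mul_assoc]

theorem RelB.comul [CharZero k] {q : k} {g h z G X : B} (R8 : Rel8 k g h z)
    (R : RelB k q g h z G X) :
    RelB k q (g ⊗ₜ[k] g : B ⊗[k] B) (h ⊗ₜ[k] h) (comulZ k g h z) (G ⊗ₜ[k] G)
      (comulX k G X) := by
  have zG := R.zG R8
  obtain ⟨gg, hh, gh, zz, gz, hz⟩ := R8
  obtain ⟨gG, hG, -, gX, hX, zX⟩ := R
  have gg2 : ∀ a, g * (g * a) = a := fun a => by rw [← mul_assoc, gg, one_mul]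
  have hh2 : ∀ a, h * (h * a) = a := fun a => by rw [← mul_assoc, hh, one_mul]
  have hg2 : ∀ a, h * (g * a) = g * (h * a) := fun a => by rw [← mul_assoc, ← gh, mul_assoc]
  have zg2 : ∀ a, z * (g * a) = h * (z * a) := fun a => by rw [← mul_assoc, ← hz, mul_assoc]
  have zh2 : ∀ a, z * (h * a) = g * (z * a) := fun a => by rw [← mul_assoc, ← gz, mul_assoc]
  have gG2 : ∀ a, g * (G * a) = G * (g * a) := fun a => by rw [← mul_assoc, gG, mul_assoc]
  have hG2 : ∀ a, h * (G * a) = G * (h * a) := fun a => by rw [← mul_assoc, hG, mul_assoc]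
  have gX2 : ∀ a, g * (X * a) = -(X * (g * a)) :=
    fun a => by rw [← mul_assoc, gX, neg_mul, mul_assoc]
  have hX2 : ∀ a, h * (X * a) = -(X * (h * a)) :=
    fun a => by rw [← mul_assoc, hX, neg_mul, mul_assoc]
  rw [mul_assoc] at zX
  have zG2 : ∀ a, z * (G * a) = G * (g * (h * (z * a))) :=
    fun a => by rw [← mul_assoc, zG]; simp only [mul_assoc]
  have zX2 : ∀ a, z * (X * a) = q • (X * (g * (z * a))) :=
    fun a => by rw [← mul_assoc, zX]; simp only [mul_assoc, smul_mul_assoc]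
  constructor <;>
  simp [comulZ, comulX, mul_add, add_mul, mul_sub, sub_mul, gG, hG, zG, gX, hX, zX,
    gG2, hG2, zG2, gX2, hX2, zX2, gg, hh, ← gh, ← gz, ← hz,
    gg2, hh2, hg2, zg2, zh2, mul_assoc, smul_add, smul_sub,
    TensorProduct.neg_tmul, TensorProduct.tmul_neg, ← TensorProduct.smul_tmul'] <;>
  module

/-- If `q ^ 2 ≠ -1`, the relations force `X = 0`. -/
theorem RelB.sq_smul [CharZero k] {q : k} {g h z G X : B} (R8 : Rel8 k g h z)
    (R : RelB k q g h z G X) : (1 + q ^ 2) • X = 0 := by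
  obtain ⟨gg, hh, gh, zz, gz, hz⟩ := R8
  obtain ⟨gG, hG, -, gX, hX, zX⟩ := R
  have gg2 : ∀ a, g * (g * a) = a := fun a => by rw [← mul_assoc, gg, one_mul]
  have hh2 : ∀ a, h * (h * a) = a := fun a => by rw [← mul_assoc, hh, one_mul]
  have hg2 : ∀ a, h * (g * a) = g * (h * a) := fun a => by rw [← mul_assoc, ← gh, mul_assoc]
  have zg2 : ∀ a, z * (g * a) = h * (z * a) := fun a => by rw [← mul_assoc, ← hz, mul_assoc]
  have gX2 : ∀ a, g * (X * a) = -(X * (g * a)) :=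
    fun a => by rw [← mul_assoc, gX, neg_mul, mul_assoc]
  rw [mul_assoc] at zX
  have zX2 : ∀ a, z * (X * a) = q • (X * (g * (z * a))) :=
    fun a => by rw [← mul_assoc, zX]; simp only [mul_assoc, smul_mul_assoc]
  have e : z * (z * X) = (z * z) * X := (mul_assoc _ _ _).symm
  rw [zz, zX] at e
  simp [mul_add, add_mul, mul_sub, sub_mul, gX, hX, zX2, gX2, zg2, hg2, zz, gg, hh, ← gh,
    gg2, hh2, mul_assoc] at e
  have e2 := congrArg (· * (1 - g - h - g * h)) e
  simp [mul_add, add_mul, mul_sub, sub_mul, gg2, hh2, hg2, gg, hh, ← gh, mul_assoc] at e2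
  have e3 := congrArg ((-1 / 2 : k) • ·) (sub_eq_zero.mpr e2)
  simp only [smul_zero] at e3
  rw [← e3]
  module

theorem RelB.op [CharZero k] {q : k} {g h z G X : B} (R8 : Rel8 k g h z)
    (R : RelB k q g h z G X) :
    RelB k q (MulOpposite.op g) (MulOpposite.op h) (MulOpposite.op z) (MulOpposite.op G)
      (MulOpposite.op (G * X)) := by
  have hq := R.sq_smul R8
  have zG := R.zG R8
  obtain ⟨gg, hh, gh, zz, gz, hz⟩ := R8
  obtain ⟨gG, hG, gzG, gX, hX, zX⟩ := R
  constructor <;> simp only [← MulOpposite.op_mul, ← MulOpposite.op_neg, ← MulOpposite.op_smul,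
    MulOpposite.op_inj]
  · exact gG.symm
  · exact hG.symm
  · rw [← hz, ← mul_assoc z h, ← gz, gzG, mul_assoc]
  · rw [← mul_assoc, gG, mul_assoc G g X, gX, mul_neg, neg_neg, mul_assoc]
  · rw [← mul_assoc, hG, mul_assoc G h X, hX, mul_neg, neg_neg, mul_assoc]
  · have gg2 : ∀ a, g * (g * a) = a := fun a => by rw [← mul_assoc, gg, one_mul]
    have hh2 : ∀ a, h * (h * a) = a := fun a => by rw [← mul_assoc, hh, one_mul]
    have hg2 : ∀ a, h * (g * a) = g * (h * a) := fun a => by rw [← mul_assoc, ← gh, mul_assoc]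
    have hX2 : ∀ a, h * (X * a) = -(X * (h * a)) :=
      fun a => by rw [← mul_assoc, hX, neg_mul, mul_assoc]
    have gX2 : ∀ a, g * (X * a) = -(X * (g * a)) :=
      fun a => by rw [← mul_assoc, gX, neg_mul, mul_assoc]
    have hG2 : ∀ a, h * (G * a) = G * (h * a) := fun a => by rw [← mul_assoc, hG, mul_assoc]
    have e : z * (g * (G * X)) = -(q • (G * (X * z))) := by
      rw [← mul_assoc z g, ← hz, mul_assoc h z, ← mul_assoc z G, zG]
      simp only [mul_assoc]
      rw [zX]
      simp [mul_assoc, hG2, hX2, gX2, gg2, hh2, hg2]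
    rw [e]
    have hX' : X = -(q ^ 2 • X) := by
      rw [add_smul, one_smul] at hq
      exact eq_neg_of_add_eq_zero_left hq
    conv_lhs => rw [hX']
    simp [pow_two, mul_smul, mul_assoc]

end

end HopfGen

namespace HopfGen

section

variable {k : Type*} [Field k] {P : Type*} [Ring P] [Algebra k P]

/-- The Hopf algebra axioms on one generator `x`, for given algebra maps `Δ`, `ε` and a given
anti-homomorphism `S`. -/
structure Ax (Δ : P →ₐ[k] P ⊗[k] P) (ε : P →ₐ[k] k) (S : P →ₐ[k] Pᵐᵒᵖ) (x : P) : Prop where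
  coassoc : Algebra.TensorProduct.assoc k k k P P P
      (Algebra.TensorProduct.map Δ (.id k P) (Δ x)) = Algebra.TensorProduct.map (.id k P) Δ (Δ x)
  rT : Algebra.TensorProduct.map ε (.id k P) (Δ x) = 1 ⊗ₜ x
  lT : Algebra.TensorProduct.map (.id k P) ε (Δ x) = x ⊗ₜ 1
  rS : LinearMap.mul' k P
      (((anti S).rTensor P) (Δ x))
        = algebraMap k P (ε x)
  lS : LinearMap.mul' k P
      (((anti S).lTensor P) (Δ x))
        = algebraMap k P (ε x)

theorem ax_groupLike {Δ : P →ₐ[k] P ⊗[k] P} {ε : P →ₐ[k] k} {S : P →ₐ[k] Pᵐᵒᵖ} {x : P}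
    (hΔ : Δ x = x ⊗ₜ x) (hε : ε x = 1) (hS : S x = MulOpposite.op x) (hx : x * x = 1) :
    Ax Δ ε S x := by
  constructor <;> simp [hΔ, hε, hS, hx]

theorem ax_X {Δ : P →ₐ[k] P ⊗[k] P} {ε : P →ₐ[k] k} {S : P →ₐ[k] Pᵐᵒᵖ} {G X : P}
    (R : Rel4 G X) (hG : Δ G = G ⊗ₜ G) (hGε : ε G = 1) (hGS : S G = MulOpposite.op G)
    (hX : Δ X = comulX k G X) (hXε : ε X = 0) (hXS : S X = MulOpposite.op (G * X)) :
    Ax Δ ε S X := by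
  obtain ⟨GG, XX, XG⟩ := R
  have GG2 : ∀ a, G * (G * a) = a := fun a => by rw [← mul_assoc, GG, one_mul]
  constructor <;>
  simp [hX, comulX, hG, hGε, hGS, hXε, hXS, XG, GG, GG2, mul_assoc, TensorProduct.add_tmul,
    TensorProduct.tmul_add, add_assoc, Algebra.TensorProduct.one_def]

theorem ax_z [CharZero k] {Δ : P →ₐ[k] P ⊗[k] P} {ε : P →ₐ[k] k} {S : P →ₐ[k] Pᵐᵒᵖ} {g h z : P}
    (R : Rel8 k g h z) (hg : Δ g = g ⊗ₜ g) (hgε : ε g = 1) (hgS : S g = MulOpposite.op g)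
    (hh : Δ h = h ⊗ₜ h) (hhε : ε h = 1) (hhS : S h = MulOpposite.op h)
    (hz : Δ z = comulZ k g h z) (hzε : ε z = 1) (hzS : S z = MulOpposite.op z) :
    Ax Δ ε S z := by
  obtain ⟨gg, hh', gh, zz, gz, hz'⟩ := R
  have gg2 : ∀ a, g * (g * a) = a := fun a => by rw [← mul_assoc, gg, one_mul]
  have hh2 : ∀ a, h * (h * a) = a := fun a => by rw [← mul_assoc, hh', one_mul]
  have hg2 : ∀ a, h * (g * a) = g * (h * a) := fun a => by rw [← mul_assoc, ← gh, mul_assoc]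
  have zg2 : ∀ a, z * (g * a) = h * (z * a) := fun a => by rw [← mul_assoc, ← hz', mul_assoc]
  have zh2 : ∀ a, z * (h * a) = g * (z * a) := fun a => by rw [← mul_assoc, ← gz, mul_assoc]
  constructor <;>
  simp [hz, comulZ, hg, hh, hgε, hgS, hhε, hhS, hzε, hzS, mul_add, add_mul, mul_sub, sub_mul,
    gg, hh', ← gh, zz, ← gz, ← hz', gg2, hh2, hg2, zg2, zh2, mul_assoc,
    Algebra.TensorProduct.one_def, TensorProduct.add_tmul, TensorProduct.tmul_add,
    TensorProduct.sub_tmul, TensorProduct.tmul_sub, smul_add, smul_sub,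
    ← TensorProduct.smul_tmul', Algebra.algebraMap_eq_smul_one] <;>
  module

/-- The Hopf algebra structure determined by its values on a generating family. -/
@[reducible] def mkGen {gen : Type*} (r : FreeAlgebra k gen → FreeAlgebra k gen → Prop)
    (Δ : RingQuot r →ₐ[k] RingQuot r ⊗[k] RingQuot r) (ε : RingQuot r →ₐ[k] k)
    (S : RingQuot r →ₐ[k] (RingQuot r)ᵐᵒᵖ)
    (h : ∀ x, Ax Δ ε S (RingQuot.mkAlgHom k r (FreeAlgebra.ι k x))) :
    HopfAlgebra k (RingQuot r) :=
  mk _ (adjoin_ringQuot r) Δ ε S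
    (by rintro _ ⟨x, rfl⟩; exact (h x).coassoc) (by rintro _ ⟨x, rfl⟩; exact (h x).rT)
    (by rintro _ ⟨x, rfl⟩; exact (h x).lT) (by rintro _ ⟨x, rfl⟩; exact (h x).rS)
    (by rintro _ ⟨x, rfl⟩; exact (h x).lS)

end

end HopfGen

/-! ## Sweedler's Hopf algebra -/

namespace H4

/-- The generators of Sweedler's Hopf algebra. -/
inductive Gen : Type
  | G
  | X

open FreeAlgebra Gen in
/-- `G ^ 2 = 1`, `X ^ 2 = 0`, `X G = - G X`. -/
inductive Rel (k : Type*) [Field k] : FreeAlgebra k Gen → FreeAlgebra k Gen → Prop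
  | GG : Rel k (ι k G * ι k G) 1
  | XX : Rel k (ι k X * ι k X) 0
  | XG : Rel k (ι k X * ι k G) (-(ι k G * ι k X))

/-- The canonical generators of the quotient of the free algebra. -/
def gen (k : Type*) [Field k] (x : Gen) : RingQuot (Rel k) :=
  RingQuot.mkAlgHom k (Rel k) (FreeAlgebra.ι k x)

theorem rel4 (k : Type*) [Field k] : HopfGen.Rel4 (gen k .G) (gen k .X) := by
  constructor
  · simpa [gen] using RingQuot.mkAlgHom_rel k (Rel.GG (k := k))
  · simpa [gen] using RingQuot.mkAlgHom_rel k (Rel.XX (k := k))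
  · simpa [gen] using RingQuot.mkAlgHom_rel k (Rel.XG (k := k))

/-- The algebra map out of the algebra given by generators and relations. -/
def lift (k : Type*) [Field k] {B : Type*} [Ring B] [Algebra k B] (f : Gen → B)
    (R4 : HopfGen.Rel4 (f .G) (f .X)) : RingQuot (Rel k) →ₐ[k] B :=
  RingQuot.liftAlgHom k ⟨FreeAlgebra.lift k f, by
    intro a b hab
    cases hab
    · simpa using R4.GG
    · simpa using R4.XX
    · simpa using R4.XG⟩

theorem lift_gen (k : Type*) [Field k] {B : Type*} [Ring B] [Algebra k B] (f : Gen → B)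
    (R4 : HopfGen.Rel4 (f .G) (f .X)) (x : Gen) : lift k f R4 (gen k x) = f x := by
  simp [lift, gen, RingQuot.liftAlgHom_mkAlgHom_apply]

/-- `Δ(G) = G ⊗ G`, `Δ(X) = X ⊗ G + 1 ⊗ X`. -/
def comulGen (k : Type*) [Field k] : Gen → RingQuot (Rel k) ⊗[k] RingQuot (Rel k)
  | .G => gen k .G ⊗ₜ gen k .G
  | .X => gen k .X ⊗ₜ gen k .G + 1 ⊗ₜ gen k .X

/-- `ε(G) = 1`, `ε(X) = 0`. -/
def counitGen (k : Type*) [Field k] : Gen → k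
  | .G => 1
  | .X => 0

/-- `S(G) = G`, `S(X) = G X`. -/
def antipodeGen (k : Type*) [Field k] : Gen → (RingQuot (Rel k))ᵐᵒᵖ
  | .G => MulOpposite.op (gen k .G)
  | .X => MulOpposite.op (gen k .G * gen k .X)

theorem rel4_counit (k : Type*) [Field k] :
    HopfGen.Rel4 (counitGen k .G) (counitGen k .X) := by
  constructor <;> simp [counitGen]

/-- The Hopf algebra structure of Sweedler's Hopf algebra. -/
@[reducible] def hopf (k : Type*) [Field k] : HopfAlgebra k (RingQuot (Rel k)) :=
  HopfGen.mkGen (Rel k)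
    (lift k (comulGen k) (rel4 k).comul)
    (lift k (counitGen k) (rel4_counit k))
    (lift k (antipodeGen k) (rel4 k).op)
    (by
      rintro (_ | _)
      · exact HopfGen.ax_groupLike (lift_gen ..) (lift_gen ..) (lift_gen ..) (rel4 k).GG
      · apply HopfGen.ax_X (rel4 k) <;> apply lift_gen)

end H4

/-- Sweedler's Hopf algebra: generated by `G`, `X` with `G ^ 2 = 1`, `X ^ 2 = 0`, `X G = - G X`;
`Δ(G) = G ⊗ G`, `Δ(X) = X ⊗ G + 1 ⊗ X`, `ε(G) = 1`, `ε(X) = 0`, `S(G) = G`, `S(X) = G X`. -/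
def H4 (k : Type*) [Field k] : Type _ := RingQuot (H4.Rel k)

instance (k : Type*) [Field k] : Ring (H4 k) := inferInstanceAs (Ring (RingQuot (H4.Rel k)))

instance (k : Type*) [Field k] : HopfAlgebra k (H4 k) := H4.hopf k

namespace H4

/-- The generator `G`. -/
def G (k : Type*) [Field k] : H4 k := gen k .G

/-- The generator `X`. -/
def X (k : Type*) [Field k] : H4 k := gen k .X

theorem comul_G (k : Type*) [Field k] : Coalgebra.comul (R := k) (G k) = G k ⊗ₜ G k :=
  lift_gen _ _ _ _

theorem comul_X (k : Type*) [Field k] :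
    Coalgebra.comul (R := k) (X k) = X k ⊗ₜ G k + 1 ⊗ₜ X k :=
  lift_gen _ _ _ _

theorem antipode_X (k : Type*) [Field k] : HopfAlgebra.antipode k (X k) = G k * X k :=
  congrArg MulOpposite.unop (lift_gen k (antipodeGen k) (rel4 k).op .X)

end H4

/-! ## The Kac-Paljutkin Hopf algebra -/

namespace H8

/-- The generators. -/
inductive Gen : Type
  | g
  | h
  | z

open FreeAlgebra Gen in
/-- The defining relations. -/
inductive Rel (k : Type*) [Field k] : FreeAlgebra k Gen → FreeAlgebra k Gen → Prop
  | gg : Rel k (ι k g * ι k g) (1)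
  | hh : Rel k (ι k h * ι k h) (1)
  | gh : Rel k (ι k g * ι k h) (ι k h * ι k g)
  | zz : Rel k (ι k z * ι k z) ((1 / 2 : k) • (1 + ι k g + ι k h - ι k g * ι k h))
  | gz : Rel k (ι k g * ι k z) (ι k z * ι k h)
  | hz : Rel k (ι k h * ι k z) (ι k z * ι k g)

/-- The canonical generators of the quotient of the free algebra. -/
def gen (k : Type*) [Field k] (x : Gen) : RingQuot (Rel k) :=
  RingQuot.mkAlgHom k (Rel k) (FreeAlgebra.ι k x)

theorem rel8 (k : Type*) [Field k] :
    HopfGen.Rel8 k (gen k .g) (gen k .h) (gen k .z) := by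
  constructor
  · simpa [gen] using RingQuot.mkAlgHom_rel k (Rel.gg (k := k))
  · simpa [gen] using RingQuot.mkAlgHom_rel k (Rel.hh (k := k))
  · simpa [gen] using RingQuot.mkAlgHom_rel k (Rel.gh (k := k))
  · simpa [gen] using RingQuot.mkAlgHom_rel k (Rel.zz (k := k))
  · simpa [gen] using RingQuot.mkAlgHom_rel k (Rel.gz (k := k))
  · simpa [gen] using RingQuot.mkAlgHom_rel k (Rel.hz (k := k))

/-- The algebra map out of the algebra given by generators and relations. -/
def lift (k : Type*) [Field k] {B : Type*} [Ring B] [Algebra k B] (f : Gen → B)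
    (R8 : HopfGen.Rel8 k (f .g) (f .h) (f .z)) :
    RingQuot (Rel k) →ₐ[k] B :=
  RingQuot.liftAlgHom k ⟨FreeAlgebra.lift k f, by
    intro a b hab
    cases hab
    · simpa using R8.gg
    · simpa using R8.hh
    · simpa using R8.gh
    · simpa using R8.zz
    · simpa using R8.gz
    · simpa using R8.hz⟩

theorem lift_gen (k : Type*) [Field k] {B : Type*} [Ring B] [Algebra k B] (f : Gen → B)
    (R8 : HopfGen.Rel8 k (f .g) (f .h) (f .z)) (x : Gen) :
    lift k f R8 (gen k x) = f x := by
  simp [lift, gen, RingQuot.liftAlgHom_mkAlgHom_apply]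

/-- `Δ(g) = g ⊗ g`, `Δ(h) = h ⊗ h`, `Δ(z) = J (z ⊗ z)` with
`J = (1/2) (1 ⊗ 1 + g ⊗ 1 + 1 ⊗ h - g ⊗ h)`. -/
def comulGen (k : Type*) [Field k] :
    Gen → RingQuot (Rel k) ⊗[k] RingQuot (Rel k)
  | .g => gen k .g ⊗ₜ gen k .g
  | .h => gen k .h ⊗ₜ gen k .h
  | .z => ((1 / 2 : k) • (1 ⊗ₜ 1 + gen k .g ⊗ₜ 1 + 1 ⊗ₜ gen k .h - gen k .g ⊗ₜ gen k .h))
      * (gen k .z ⊗ₜ gen k .z)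

/-- `ε(g) = ε(h) = ε(z) = 1`. -/
def counitGen (k : Type*) [Field k] : Gen → k
  | .g => 1
  | .h => 1
  | .z => 1

/-- `S(g) = g`, `S(h) = h`, `S(z) = z`. -/
def antipodeGen (k : Type*) [Field k] : Gen → (RingQuot (Rel k))ᵐᵒᵖ
  | .g => MulOpposite.op (gen k .g)
  | .h => MulOpposite.op (gen k .h)
  | .z => MulOpposite.op (gen k .z)

theorem rel8_counit (k : Type*) [Field k] [CharZero k] :
    HopfGen.Rel8 k (counitGen k .g) (counitGen k .h) (counitGen k .z) := by
  constructor <;> simp [counitGen] <;> norm_num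

/-- The Hopf algebra structure. -/
@[reducible] def hopf (k : Type*) [Field k] [CharZero k] : HopfAlgebra k (RingQuot (Rel k)) :=
  HopfGen.mkGen (Rel k)
    (lift k (comulGen k) (rel8 k).comul)
    (lift k (counitGen k) (rel8_counit k))
    (lift k (antipodeGen k) (rel8 k).op)
    (by
      rintro (_ | _ | _)
      · exact HopfGen.ax_groupLike (lift_gen ..) (lift_gen ..) (lift_gen ..) (rel8 k).gg
      · exact HopfGen.ax_groupLike (lift_gen ..) (lift_gen ..) (lift_gen ..) (rel8 k).hh
      · apply HopfGen.ax_z (rel8 k) <;> apply lift_gen)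

end H8

/-- The Kac-Paljutkin Hopf algebra: generated by `g`, `h`, `z` with `g ^ 2 = h ^ 2 = 1`, `g h = h g`,
`z ^ 2 = (1/2) (1 + g + h - g h)`, `g z = z h`, `h z = z g`; `g` and `h` are group-like,
`Δ(z) = J (z ⊗ z)` with `J = (1/2) (1 ⊗ 1 + g ⊗ 1 + 1 ⊗ h - g ⊗ h)`, `ε(z) = 1`, and the antipode
fixes `g`, `h` and `z`. -/
def H8 (k : Type*) [Field k] : Type _ := RingQuot (H8.Rel k)

instance (k : Type*) [Field k] : Ring (H8 k) :=
  inferInstanceAs (Ring (RingQuot (H8.Rel k)))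

instance (k : Type*) [Field k] [CharZero k] : HopfAlgebra k (H8 k) := H8.hopf k

namespace H8

/-- The generator `g`. -/
def g (k : Type*) [Field k] : H8 k := gen k .g

/-- The generator `h`. -/
def h (k : Type*) [Field k] : H8 k := gen k .h

/-- The generator `z`. -/
def z (k : Type*) [Field k] : H8 k := gen k .z

theorem comul_z (k : Type*) [Field k] [CharZero k] :
    Coalgebra.comul (R := k) (z k)
      = ((1 / 2 : k) • ((1 : H8 k) ⊗ₜ[k] (1 : H8 k) + g k ⊗ₜ 1 + 1 ⊗ₜ h k
          - g k ⊗ₜ h k)) * (z k ⊗ₜ z k) :=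
  lift_gen _ _ _ _

end H8

/-! ## The first 32-dimensional Hopf algebra -/

namespace H32A

/-- The generators. -/
inductive Gen : Type
  | g
  | h
  | z
  | G
  | X

open FreeAlgebra Gen in
/-- The relations of `H8`, those of `H4`, and the cross relations. -/
inductive Rel (k : Type*) [Field k] : FreeAlgebra k Gen → FreeAlgebra k Gen → Prop
  | gg : Rel k (ι k g * ι k g) (1)
  | hh : Rel k (ι k h * ι k h) (1)
  | gh : Rel k (ι k g * ι k h) (ι k h * ι k g)
  | zz : Rel k (ι k z * ι k z) ((1 / 2 : k) • (1 + ι k g + ι k h - ι k g * ι k h))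
  | gz : Rel k (ι k g * ι k z) (ι k z * ι k h)
  | hz : Rel k (ι k h * ι k z) (ι k z * ι k g)
  | GG : Rel k (ι k G * ι k G) (1)
  | XX : Rel k (ι k X * ι k X) (0)
  | XG : Rel k (ι k G * ι k X) (-(ι k X * ι k G))
  | gG : Rel k (ι k g * ι k G) (ι k G * ι k g)
  | hG : Rel k (ι k h * ι k G) (ι k G * ι k h)
  | zG : Rel k (ι k z * ι k G) (ι k G * ι k z)
  | gX : Rel k (ι k g * ι k X) (ι k X * ι k g)
  | hX : Rel k (ι k h * ι k X) (ι k X * ι k h)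
  | zX : Rel k (ι k z * ι k X) (-(ι k X * ι k z))

/-- The canonical generators of the quotient of the free algebra. -/
def gen (k : Type*) [Field k] (x : Gen) : RingQuot (Rel k) :=
  RingQuot.mkAlgHom k (Rel k) (FreeAlgebra.ι k x)

theorem rel8 (k : Type*) [Field k] :
    HopfGen.Rel8 k (gen k .g) (gen k .h) (gen k .z) := by
  constructor
  · simpa [gen] using RingQuot.mkAlgHom_rel k (Rel.gg (k := k))
  · simpa [gen] using RingQuot.mkAlgHom_rel k (Rel.hh (k := k))
  · simpa [gen] using RingQuot.mkAlgHom_rel k (Rel.gh (k := k))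
  · simpa [gen] using RingQuot.mkAlgHom_rel k (Rel.zz (k := k))
  · simpa [gen] using RingQuot.mkAlgHom_rel k (Rel.gz (k := k))
  · simpa [gen] using RingQuot.mkAlgHom_rel k (Rel.hz (k := k))

theorem rel4 (k : Type*) [Field k] :
    HopfGen.Rel4 (gen k .G) (gen k .X) := by
  constructor
  · simpa [gen] using RingQuot.mkAlgHom_rel k (Rel.GG (k := k))
  · simpa [gen] using RingQuot.mkAlgHom_rel k (Rel.XX (k := k))
  · have := RingQuot.mkAlgHom_rel k (Rel.XG (k := k))
    simp only [map_mul, map_neg] at this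
    exact (neg_eq_iff_eq_neg.mpr this).symm

theorem relC (k : Type*) [Field k] :
    HopfGen.RelA (gen k .g) (gen k .h) (gen k .z) (gen k .G) (gen k .X) := by
  constructor
  · simpa [gen] using RingQuot.mkAlgHom_rel k (Rel.gG (k := k))
  · simpa [gen] using RingQuot.mkAlgHom_rel k (Rel.hG (k := k))
  · simpa [gen] using RingQuot.mkAlgHom_rel k (Rel.zG (k := k))
  · simpa [gen] using RingQuot.mkAlgHom_rel k (Rel.gX (k := k))
  · simpa [gen] using RingQuot.mkAlgHom_rel k (Rel.hX (k := k))
  · simpa [gen] using RingQuot.mkAlgHom_rel k (Rel.zX (k := k))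

/-- The algebra map out of the algebra given by generators and relations. -/
def lift (k : Type*) [Field k] {B : Type*} [Ring B] [Algebra k B] (f : Gen → B)
    (R8 : HopfGen.Rel8 k (f .g) (f .h) (f .z))
    (R4 : HopfGen.Rel4 (f .G) (f .X))
    (RC : HopfGen.RelA (f .g) (f .h) (f .z) (f .G) (f .X)) :
    RingQuot (Rel k) →ₐ[k] B :=
  RingQuot.liftAlgHom k ⟨FreeAlgebra.lift k f, by
    intro a b hab
    cases hab
    · simpa using R8.gg
    · simpa using R8.hh
    · simpa using R8.gh
    · simpa using R8.zz
    · simpa using R8.gz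
    · simpa using R8.hz
    · simpa using R4.GG
    · simpa using R4.XX
    · simpa using (neg_eq_iff_eq_neg.mpr R4.XG).symm
    · simpa using RC.gG
    · simpa using RC.hG
    · simpa using RC.zG
    · simpa using RC.gX
    · simpa using RC.hX
    · simpa using RC.zX⟩

theorem lift_gen (k : Type*) [Field k] {B : Type*} [Ring B] [Algebra k B] (f : Gen → B)
    (R8 : HopfGen.Rel8 k (f .g) (f .h) (f .z))
    (R4 : HopfGen.Rel4 (f .G) (f .X))
    (RC : HopfGen.RelA (f .g) (f .h) (f .z) (f .G) (f .X)) (x : Gen) :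
    lift k f R8 R4 RC (gen k x) = f x := by
  simp [lift, gen, RingQuot.liftAlgHom_mkAlgHom_apply]

/-- `Δ(g) = g ⊗ g`, `Δ(h) = h ⊗ h`, `Δ(z) = J (z ⊗ z)` with
`J = (1/2) (1 ⊗ 1 + g ⊗ 1 + 1 ⊗ h - g ⊗ h)`, `Δ(G) = G ⊗ G`, `Δ(X) = X ⊗ G + 1 ⊗ X`. -/
def comulGen (k : Type*) [Field k] :
    Gen → RingQuot (Rel k) ⊗[k] RingQuot (Rel k)
  | .g => gen k .g ⊗ₜ gen k .g
  | .h => gen k .h ⊗ₜ gen k .h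
  | .z => ((1 / 2 : k) • (1 ⊗ₜ 1 + gen k .g ⊗ₜ 1 + 1 ⊗ₜ gen k .h - gen k .g ⊗ₜ gen k .h))
      * (gen k .z ⊗ₜ gen k .z)
  | .G => gen k .G ⊗ₜ gen k .G
  | .X => gen k .X ⊗ₜ gen k .G + 1 ⊗ₜ gen k .X

/-- `ε(g) = ε(h) = ε(z) = 1`, `ε(G) = 1`, `ε(X) = 0`. -/
def counitGen (k : Type*) [Field k] : Gen → k
  | .g => 1
  | .h => 1
  | .z => 1
  | .G => 1
  | .X => 0

/-- `S(g) = g`, `S(h) = h`, `S(z) = z`, `S(G) = G`, `S(X) = G X`. -/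
def antipodeGen (k : Type*) [Field k] : Gen → (RingQuot (Rel k))ᵐᵒᵖ
  | .g => MulOpposite.op (gen k .g)
  | .h => MulOpposite.op (gen k .h)
  | .z => MulOpposite.op (gen k .z)
  | .G => MulOpposite.op (gen k .G)
  | .X => MulOpposite.op (gen k .G * gen k .X)

theorem rel8_counit (k : Type*) [Field k] [CharZero k] :
    HopfGen.Rel8 k (counitGen k .g) (counitGen k .h) (counitGen k .z) := by
  constructor <;> simp [counitGen] <;> norm_num

theorem rel4_counit (k : Type*) [Field k] :
    HopfGen.Rel4 (counitGen k .G) (counitGen k .X) := by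
  constructor <;> simp [counitGen]

theorem relC_counit (k : Type*) [Field k] :
    HopfGen.RelA (counitGen k .g) (counitGen k .h) (counitGen k .z) (counitGen k .G) (counitGen k .X) := by
  constructor <;> simp [counitGen]

/-- The Hopf algebra structure. -/
@[reducible] def hopf (k : Type*) [Field k] [CharZero k] : HopfAlgebra k (RingQuot (Rel k)) :=
  HopfGen.mkGen (Rel k)
    (lift k (comulGen k) (rel8 k).comul (rel4 k).comul (relC k).comul)
    (lift k (counitGen k) (rel8_counit k) (rel4_counit k) (relC_counit k))
    (lift k (antipodeGen k) (rel8 k).op (rel4 k).op (relC k).op)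
    (by
      rintro (_ | _ | _ | _ | _)
      · exact HopfGen.ax_groupLike (lift_gen ..) (lift_gen ..) (lift_gen ..) (rel8 k).gg
      · exact HopfGen.ax_groupLike (lift_gen ..) (lift_gen ..) (lift_gen ..) (rel8 k).hh
      · apply HopfGen.ax_z (rel8 k) <;> apply lift_gen
      · exact HopfGen.ax_groupLike (lift_gen ..) (lift_gen ..) (lift_gen ..) (rel4 k).GG
      · apply HopfGen.ax_X (rel4 k) <;> apply lift_gen)

end H32A

/-- The Hopf algebra `H_{32,1}`: generated by `g`, `h`, `z`, `G`, `X` with the relations of `H8`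
and of `H4` and `g G = G g`, `h G = G h`, `z G = G z`, `g X = X g`, `h X = X h`, `z X = - X z`;
the comultiplication, counit and antipode are those of `H8` and `H4` on the generators. -/
def H32A (k : Type*) [Field k] : Type _ := RingQuot (H32A.Rel k)

instance (k : Type*) [Field k] : Ring (H32A k) :=
  inferInstanceAs (Ring (RingQuot (H32A.Rel k)))

instance (k : Type*) [Field k] [CharZero k] : HopfAlgebra k (H32A k) := H32A.hopf k

namespace H32A

/-- The generator `g`. -/
def g (k : Type*) [Field k] : H32A k := gen k .g

/-- The generator `h`. -/
def h (k : Type*) [Field k] : H32A k := gen k .h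

/-- The generator `z`. -/
def z (k : Type*) [Field k] : H32A k := gen k .z

/-- The generator `G`. -/
def G (k : Type*) [Field k] : H32A k := gen k .G

/-- The generator `X`. -/
def X (k : Type*) [Field k] : H32A k := gen k .X

theorem comul_z (k : Type*) [Field k] [CharZero k] :
    Coalgebra.comul (R := k) (z k)
      = ((1 / 2 : k) • ((1 : H32A k) ⊗ₜ[k] (1 : H32A k) + g k ⊗ₜ 1 + 1 ⊗ₜ h k
          - g k ⊗ₜ h k)) * (z k ⊗ₜ z k) :=
  lift_gen _ _ _ _ _ _

end H32A

/-! ## The other two 32-dimensional Hopf algebras -/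

namespace H32B

/-- The generators. -/
inductive Gen : Type
  | g
  | h
  | z
  | G
  | X

open FreeAlgebra Gen in
/-- The relations of `H8`, those of `H4`, and the cross relations with the parameter `q`. -/
inductive Rel (k : Type*) [Field k] (q : k) : FreeAlgebra k Gen → FreeAlgebra k Gen → Prop
  | gg : Rel k q (ι k g * ι k g) (1)
  | hh : Rel k q (ι k h * ι k h) (1)
  | gh : Rel k q (ι k g * ι k h) (ι k h * ι k g)
  | zz : Rel k q (ι k z * ι k z) ((1 / 2 : k) • (1 + ι k g + ι k h - ι k g * ι k h))
  | gz : Rel k q (ι k g * ι k z) (ι k z * ι k h)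
  | hz : Rel k q (ι k h * ι k z) (ι k z * ι k g)
  | GG : Rel k q (ι k G * ι k G) (1)
  | XX : Rel k q (ι k X * ι k X) (0)
  | XG : Rel k q (ι k G * ι k X) (-(ι k X * ι k G))
  | gG : Rel k q (ι k g * ι k G) (ι k G * ι k g)
  | hG : Rel k q (ι k h * ι k G) (ι k G * ι k h)
  | gzG : Rel k q (ι k g * ι k z * ι k G) (ι k G * ι k h * ι k z)
  | gX : Rel k q (ι k g * ι k X) (-(ι k X * ι k g))
  | hX : Rel k q (ι k h * ι k X) (-(ι k X * ι k h))
  | zX : Rel k q (ι k z * ι k X) (q • (ι k X * ι k g * ι k z))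

/-- The canonical generators of the quotient of the free algebra. -/
def gen (k : Type*) [Field k] (q : k) (x : Gen) : RingQuot (Rel k q) :=
  RingQuot.mkAlgHom k (Rel k q) (FreeAlgebra.ι k x)

theorem rel8 (k : Type*) [Field k] (q : k) :
    HopfGen.Rel8 k (gen k q .g) (gen k q .h) (gen k q .z) := by
  constructor
  · simpa [gen] using RingQuot.mkAlgHom_rel k (Rel.gg (k := k) (q := q))
  · simpa [gen] using RingQuot.mkAlgHom_rel k (Rel.hh (k := k) (q := q))
  · simpa [gen] using RingQuot.mkAlgHom_rel k (Rel.gh (k := k) (q := q))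
  · simpa [gen] using RingQuot.mkAlgHom_rel k (Rel.zz (k := k) (q := q))
  · simpa [gen] using RingQuot.mkAlgHom_rel k (Rel.gz (k := k) (q := q))
  · simpa [gen] using RingQuot.mkAlgHom_rel k (Rel.hz (k := k) (q := q))

theorem rel4 (k : Type*) [Field k] (q : k) :
    HopfGen.Rel4 (gen k q .G) (gen k q .X) := by
  constructor
  · simpa [gen] using RingQuot.mkAlgHom_rel k (Rel.GG (k := k) (q := q))
  · simpa [gen] using RingQuot.mkAlgHom_rel k (Rel.XX (k := k) (q := q))
  · have := RingQuot.mkAlgHom_rel k (Rel.XG (k := k) (q := q))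
    simp only [map_mul, map_neg] at this
    exact (neg_eq_iff_eq_neg.mpr this).symm

theorem relC (k : Type*) [Field k] (q : k) :
    HopfGen.RelB k q (gen k q .g) (gen k q .h) (gen k q .z) (gen k q .G) (gen k q .X) := by
  constructor
  · simpa [gen] using RingQuot.mkAlgHom_rel k (Rel.gG (k := k) (q := q))
  · simpa [gen] using RingQuot.mkAlgHom_rel k (Rel.hG (k := k) (q := q))
  · simpa [gen] using RingQuot.mkAlgHom_rel k (Rel.gzG (k := k) (q := q))
  · simpa [gen] using RingQuot.mkAlgHom_rel k (Rel.gX (k := k) (q := q))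
  · simpa [gen] using RingQuot.mkAlgHom_rel k (Rel.hX (k := k) (q := q))
  · simpa [gen] using RingQuot.mkAlgHom_rel k (Rel.zX (k := k) (q := q))

/-- The algebra map out of the algebra given by generators and relations. -/
def lift (k : Type*) [Field k] (q : k) {B : Type*} [Ring B] [Algebra k B] (f : Gen → B)
    (R8 : HopfGen.Rel8 k (f .g) (f .h) (f .z))
    (R4 : HopfGen.Rel4 (f .G) (f .X))
    (RC : HopfGen.RelB k q (f .g) (f .h) (f .z) (f .G) (f .X)) :
    RingQuot (Rel k q) →ₐ[k] B :=
  RingQuot.liftAlgHom k ⟨FreeAlgebra.lift k f, by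
    intro a b hab
    cases hab
    · simpa using R8.gg
    · simpa using R8.hh
    · simpa using R8.gh
    · simpa using R8.zz
    · simpa using R8.gz
    · simpa using R8.hz
    · simpa using R4.GG
    · simpa using R4.XX
    · simpa using (neg_eq_iff_eq_neg.mpr R4.XG).symm
    · simpa using RC.gG
    · simpa using RC.hG
    · simpa using RC.gzG
    · simpa using RC.gX
    · simpa using RC.hX
    · simpa using RC.zX⟩

theorem lift_gen (k : Type*) [Field k] (q : k) {B : Type*} [Ring B] [Algebra k B] (f : Gen → B)
    (R8 : HopfGen.Rel8 k (f .g) (f .h) (f .z))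
    (R4 : HopfGen.Rel4 (f .G) (f .X))
    (RC : HopfGen.RelB k q (f .g) (f .h) (f .z) (f .G) (f .X)) (x : Gen) :
    lift k q f R8 R4 RC (gen k q x) = f x := by
  simp [lift, gen, RingQuot.liftAlgHom_mkAlgHom_apply]

/-- `Δ(g) = g ⊗ g`, `Δ(h) = h ⊗ h`, `Δ(z) = J (z ⊗ z)` with
`J = (1/2) (1 ⊗ 1 + g ⊗ 1 + 1 ⊗ h - g ⊗ h)`, `Δ(G) = G ⊗ G`, `Δ(X) = X ⊗ G + 1 ⊗ X`. -/
def comulGen (k : Type*) [Field k] (q : k) :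
    Gen → RingQuot (Rel k q) ⊗[k] RingQuot (Rel k q)
  | .g => gen k q .g ⊗ₜ gen k q .g
  | .h => gen k q .h ⊗ₜ gen k q .h
  | .z => ((1 / 2 : k) • (1 ⊗ₜ 1 + gen k q .g ⊗ₜ 1 + 1 ⊗ₜ gen k q .h - gen k q .g ⊗ₜ gen k q .h))
      * (gen k q .z ⊗ₜ gen k q .z)
  | .G => gen k q .G ⊗ₜ gen k q .G
  | .X => gen k q .X ⊗ₜ gen k q .G + 1 ⊗ₜ gen k q .X

/-- `ε(g) = ε(h) = ε(z) = 1`, `ε(G) = 1`, `ε(X) = 0`. -/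
def counitGen (k : Type*) [Field k] : Gen → k
  | .g => 1
  | .h => 1
  | .z => 1
  | .G => 1
  | .X => 0

/-- `S(g) = g`, `S(h) = h`, `S(z) = z`, `S(G) = G`, `S(X) = G X`. -/
def antipodeGen (k : Type*) [Field k] (q : k) : Gen → (RingQuot (Rel k q))ᵐᵒᵖ
  | .g => MulOpposite.op (gen k q .g)
  | .h => MulOpposite.op (gen k q .h)
  | .z => MulOpposite.op (gen k q .z)
  | .G => MulOpposite.op (gen k q .G)
  | .X => MulOpposite.op (gen k q .G * gen k q .X)

theorem rel8_counit (k : Type*) [Field k] [CharZero k] :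
    HopfGen.Rel8 k (counitGen k .g) (counitGen k .h) (counitGen k .z) := by
  constructor <;> simp [counitGen] <;> norm_num

theorem rel4_counit (k : Type*) [Field k] :
    HopfGen.Rel4 (counitGen k .G) (counitGen k .X) := by
  constructor <;> simp [counitGen]

theorem relC_counit (k : Type*) [Field k] (q : k) :
    HopfGen.RelB k q (counitGen k .g) (counitGen k .h) (counitGen k .z) (counitGen k .G) (counitGen k .X) := by
  constructor <;> simp [counitGen]

/-- The Hopf algebra structure. -/
@[reducible] def hopf (k : Type*) [Field k] [CharZero k] (q : k) : HopfAlgebra k (RingQuot (Rel k q)) :=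
  HopfGen.mkGen (Rel k q)
    (lift k q (comulGen k q) (rel8 k q).comul (rel4 k q).comul ((relC k q).comul (rel8 k q)))
    (lift k q (counitGen k) (rel8_counit k) (rel4_counit k) (relC_counit k q))
    (lift k q (antipodeGen k q) (rel8 k q).op (rel4 k q).op ((relC k q).op (rel8 k q)))
    (by
      rintro (_ | _ | _ | _ | _)
      · exact HopfGen.ax_groupLike (lift_gen ..) (lift_gen ..) (lift_gen ..) (rel8 k q).gg
      · exact HopfGen.ax_groupLike (lift_gen ..) (lift_gen ..) (lift_gen ..) (rel8 k q).hh
      · apply HopfGen.ax_z (rel8 k q) <;> apply lift_gen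
      · exact HopfGen.ax_groupLike (lift_gen ..) (lift_gen ..) (lift_gen ..) (rel4 k q).GG
      · apply HopfGen.ax_X (rel4 k q) <;> apply lift_gen)

end H32B

/-- The Hopf algebras `H_{32,2}` and `H_{32,3}`, obtained for `q = i` and `q = -i` where `i` is a
square root of `-1`: generated by `g`, `h`, `z`, `G`, `X` with the relations of `H8` and of `H4` and
`g G = G g`, `h G = G h`, `g z G = G h z`, `g X = - X g`, `h X = - X h`, `z X = q X g z`;
the comultiplication, counit and antipode are those of `H8` and `H4` on the generators. -/
def H32B (k : Type*) [Field k] (q : k) : Type _ := RingQuot (H32B.Rel k q)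

instance (k : Type*) [Field k] (q : k) : Ring (H32B k q) :=
  inferInstanceAs (Ring (RingQuot (H32B.Rel k q)))

instance (k : Type*) [Field k] [CharZero k] (q : k) : HopfAlgebra k (H32B k q) := H32B.hopf k q

namespace H32B

/-- The generator `g`. -/
def g (k : Type*) [Field k] (q : k) : H32B k q := gen k q .g

/-- The generator `h`. -/
def h (k : Type*) [Field k] (q : k) : H32B k q := gen k q .h

/-- The generator `z`. -/
def z (k : Type*) [Field k] (q : k) : H32B k q := gen k q .z

/-- The generator `G`. -/
def G (k : Type*) [Field k] (q : k) : H32B k q := gen k q .G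

/-- The generator `X`. -/
def X (k : Type*) [Field k] (q : k) : H32B k q := gen k q .X

theorem comul_z (k : Type*) [Field k] [CharZero k] (q : k) :
    Coalgebra.comul (R := k) (z k q)
      = ((1 / 2 : k) • ((1 : H32B k q) ⊗ₜ[k] (1 : H32B k q) + g k q ⊗ₜ 1 + 1 ⊗ₜ h k q
          - g k q ⊗ₜ h k q)) * (z k q ⊗ₜ z k q) :=
  lift_gen _ _ _ _ _ _ _

end H32B

/-! ## Factorizations and bicrossed products -/

section

open TensorProduct

universe u v w x

/-- The Hopf algebra `E` factorizes through the Hopf algebras `A` and `H`: there are injective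
morphisms of Hopf algebras `i : A → E` and `j : H → E` such that `A ⊗ H → E`, `a ⊗ h ↦ i(a) j(h)`,
is bijective. (A bialgebra morphism of Hopf algebras automatically commutes with the antipodes.) -/
def FactorizesThrough (k : Type u) [Field k] (A : Type v) (H : Type w) (E : Type x)
    [Ring A] [HopfAlgebra k A] [Ring H] [HopfAlgebra k H] [Ring E] [HopfAlgebra k E] : Prop :=
  ∃ (i : A →ₐc[k] E) (j : H →ₐc[k] E), Function.Injective i ∧ Function.Injective j ∧
    Function.Bijective (TensorProduct.lift
      ((LinearMap.mul k E).compl₁₂ (i : A →ₗ[k] E) (j : H →ₗ[k] E)))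

/-- A matched pair of Hopf algebras `(A, H, ▷, ◁)`: coalgebra maps `▷ : H ⊗ A → A` (`act`) and
`◁ : H ⊗ A → H` (`coact`) making `A` a left `H`-module coalgebra and `H` a right `A`-module
coalgebra, with the compatibility conditions. In the conditions, `comul (h ⊗ₜ a)` is
`∑ (h₁ ⊗ a₁) ⊗ (h₂ ⊗ a₂)`, the comultiplication of the coalgebra `H ⊗ A`. -/
structure MatchedPair (k : Type u) [Field k] (A : Type v) (H : Type w)
    [Ring A] [HopfAlgebra k A] [Ring H] [HopfAlgebra k H] where
  /-- The left action `▷`. -/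
  act : H ⊗[k] A →ₗc[k] A
  /-- The right action `◁`. -/
  coact : H ⊗[k] A →ₗc[k] H
  one_act : ∀ a : A, act (1 ⊗ₜ a) = a
  mul_act : ∀ (g h : H) (a : A), act ((g * h) ⊗ₜ a) = act (g ⊗ₜ act (h ⊗ₜ a))
  coact_one : ∀ h : H, coact (h ⊗ₜ 1) = h
  coact_mul : ∀ (h : H) (a b : A), coact (h ⊗ₜ (a * b)) = coact (coact (h ⊗ₜ a) ⊗ₜ b)
  /-- `h ▷ 1 = ε(h) 1`. -/
  act_one : ∀ h : H, act (h ⊗ₜ 1) = Coalgebra.counit (R := k) h • (1 : A)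
  /-- `1 ◁ a = ε(a) 1`. -/
  one_coact : ∀ a : A, coact (1 ⊗ₜ a) = Coalgebra.counit (R := k) a • (1 : H)
  /-- `h ▷ (a b) = ∑ (h₁ ▷ a₁) ((h₂ ◁ a₂) ▷ b)`. -/
  act_mul : ∀ (h : H) (a b : A), act (h ⊗ₜ (a * b)) =
    LinearMap.mul' k A (TensorProduct.map (act : H ⊗[k] A →ₗ[k] A)
      ((act : H ⊗[k] A →ₗ[k] A) ∘ₗ (TensorProduct.mk k H A).flip b ∘ₗ
        (coact : H ⊗[k] A →ₗ[k] H))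
      (Coalgebra.comul (R := k) (h ⊗ₜ[k] a)))
  /-- `(g h) ◁ a = ∑ (g ◁ (h₁ ▷ a₁)) (h₂ ◁ a₂)`. -/
  mul_coact : ∀ (g h : H) (a : A), coact ((g * h) ⊗ₜ a) =
    LinearMap.mul' k H (TensorProduct.map
      ((coact : H ⊗[k] A →ₗ[k] H) ∘ₗ TensorProduct.mk k H A g ∘ₗ (act : H ⊗[k] A →ₗ[k] A))
      (coact : H ⊗[k] A →ₗ[k] H)
      (Coalgebra.comul (R := k) (h ⊗ₜ[k] a)))
  /-- `∑ (h₁ ◁ a₁) ⊗ (h₂ ▷ a₂) = ∑ (h₂ ◁ a₂) ⊗ (h₁ ▷ a₁)`. -/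
  compat : ∀ (h : H) (a : A),
    TensorProduct.map (coact : H ⊗[k] A →ₗ[k] H) (act : H ⊗[k] A →ₗ[k] A)
      (Coalgebra.comul (R := k) (h ⊗ₜ[k] a)) =
    TensorProduct.comm k A H (TensorProduct.map (act : H ⊗[k] A →ₗ[k] A)
      (coact : H ⊗[k] A →ₗ[k] H) (Coalgebra.comul (R := k) (h ⊗ₜ[k] a)))

/-- The product of the bicrossed product `A ⋈ H` on `A ⊗ H`:
`(a ⋈ h) (b ⋈ g) = ∑ a (h₁ ▷ b₁) ⋈ (h₂ ◁ b₂) g`. -/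
def MatchedPair.prod {k : Type u} [Field k] {A : Type v} {H : Type w}
    [Ring A] [HopfAlgebra k A] [Ring H] [HopfAlgebra k H] (M : MatchedPair k A H)
    (a : A) (h : H) (b : A) (g : H) : A ⊗[k] H :=
  TensorProduct.map (LinearMap.mulLeft k a ∘ₗ (M.act : H ⊗[k] A →ₗ[k] A))
    (LinearMap.mulRight k g ∘ₗ (M.coact : H ⊗[k] A →ₗ[k] H))
    (Coalgebra.comul (R := k) (h ⊗ₜ[k] b))

/-- The Hopf algebra `E` is (isomorphic to) a bicrossed product `A ⋈ H`: for some matched pair, `E`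
is identified, as a coalgebra, with the tensor product coalgebra `A ⊗ H` in such a way that the
unit is `1 ⊗ 1` and the product is that of `A ⋈ H`. (The antipode is determined by this.) -/
def IsBicrossedProduct (k : Type u) [Field k] (A : Type v) (H : Type w) (E : Type x)
    [Ring A] [HopfAlgebra k A] [Ring H] [HopfAlgebra k H] [Ring E] [HopfAlgebra k E] : Prop :=
  ∃ (M : MatchedPair k A H) (φ : (A ⊗[k] H) ≃ₗc[k] E), φ (1 ⊗ₜ 1) = 1 ∧
    ∀ (a : A) (h : H) (b : A) (g : H), φ (a ⊗ₜ h) * φ (b ⊗ₜ g) = φ (M.prod a h b g)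

end

end

/-!
A bialgebra `E` with bialgebra maps `i : A → E` and `j : H → E` for which `a ⊗ h ↦ i(a) j(h)` is
bijective is the same as a bicrossed product of `A` and `H`: the actions are read off from
`j(h) i(a) = i(h₁ ▷ a₁) j(h₂ ◁ a₂)`. The antipodes of `H4` and `H8` have order dividing `4`, hence
so does that of `E`, and applying it exchanges the two factors.

Let `A = H8` and `H = H4`. The action of `A` on `G` is trivial, and
`X ◁ a = χ(a) X + ψ(a) (1 - G)` for a character `χ` of `A`; the relation `X² = 0` forces `ψ = 0`.
Then `X` acts on `A` by `0`, and `G` and `X` are moved past `A` by the winding maps of `χ`, so that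
`E` is determined by `χ`. The character `χ` is determined by `χ(z)`, a fourth root of unity, and the
values `1`, `-1`, `i`, `-i` give `H8 ⊗ H4`, `H_{32,1}`, `H_{32,2}`, `H_{32,3}`. Conversely, each of
these algebras acts on `A ⊗ H`, which shows that it has the right dimension.
-/

noncomputable section

open TensorProduct
open Coalgebra (comul counit)

/-! ### Factorizations of bialgebras -/

section Projections

variable (R A H : Type*) [CommSemiring R]
  [AddCommMonoid A] [Module R A] [Coalgebra R A] [AddCommMonoid H] [Module R H] [Coalgebra R H]

/-- The projection `a ⊗ h ↦ ε(h) a` of a tensor product of coalgebras. -/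
def tensorFst : A ⊗[R] H →ₗc[R] A :=
  (Coalgebra.TensorProduct.rid R R A : A ⊗[R] R →ₗc[R] A).comp
    (Coalgebra.TensorProduct.map (.id R A) (Coalgebra.counitCoalgHom R H))

/-- The projection `a ⊗ h ↦ ε(a) h` of a tensor product of coalgebras. -/
def tensorSnd : A ⊗[R] H →ₗc[R] H :=
  (Coalgebra.TensorProduct.lid R H : R ⊗[R] H →ₗc[R] H).comp
    (Coalgebra.TensorProduct.map (Coalgebra.counitCoalgHom R A) (.id R H))

variable {A H}

@[simp] theorem tensorFst_tmul (a : A) (h : H) :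
    tensorFst R A H (a ⊗ₜ h) = counit (R := R) h • a := rfl

@[simp] theorem tensorSnd_tmul (a : A) (h : H) :
    tensorSnd R A H (a ⊗ₜ h) = counit (R := R) a • h := rfl

theorem map_tensorFst_tensorSnd_comul (t : A ⊗[R] H) :
    map (tensorFst R A H : A ⊗[R] H →ₗ[R] A) (tensorSnd R A H : A ⊗[R] H →ₗ[R] H) (comul t) =
      t := by
  have regroup : map (tensorFst R A H : A ⊗[R] H →ₗ[R] A) (tensorSnd R A H : A ⊗[R] H →ₗ[R] H) ∘ₗ
        (AlgebraTensorModule.tensorTensorTensorComm R R R R A A H H).toLinearMap =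
      map ((TensorProduct.rid R A).toLinearMap ∘ₗ counit.lTensor A)
        ((TensorProduct.lid R H).toLinearMap ∘ₗ counit.rTensor H) := by
    ext a a' h h'
    simp [smul_tmul', tmul_smul, smul_smul, mul_comm]
  induction t with
  | zero => simp
  | add x y hx hy => rw [map_add, map_add, hx, hy]
  | tmul a h =>
    rw [comul_tmul]
    exact (LinearMap.congr_fun regroup _).trans (by simp)

theorem map_tensorSnd_tensorFst_comul (t : A ⊗[R] H) :
    map (tensorSnd R A H : A ⊗[R] H →ₗ[R] H) (tensorFst R A H : A ⊗[R] H →ₗ[R] A) (comul t) =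
      TensorProduct.comm R A H t := by
  have regroup : map (tensorSnd R A H : A ⊗[R] H →ₗ[R] H) (tensorFst R A H : A ⊗[R] H →ₗ[R] A) ∘ₗ
        (AlgebraTensorModule.tensorTensorTensorComm R R R R A A H H).toLinearMap =
      (TensorProduct.comm R A H).toLinearMap ∘ₗ
        map ((TensorProduct.lid R A).toLinearMap ∘ₗ counit.rTensor A)
          ((TensorProduct.rid R H).toLinearMap ∘ₗ counit.lTensor H) := by
    ext a a' h h'
    simp [smul_tmul', tmul_smul, smul_smul, mul_comm]
  induction t with
  | zero => simp
  | add x y hx hy => rw [map_add, map_add, hx, hy, map_add]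
  | tmul a h =>
    rw [comul_tmul]
    exact (LinearMap.congr_fun regroup _).trans (by simp)

end Projections

section Inclusions

variable (R A H : Type*) [CommSemiring R] [Semiring A] [Bialgebra R A] [Semiring H] [Bialgebra R H]

/-- The inclusion `a ↦ a ⊗ 1` of the first factor of a tensor product of bialgebras. -/
def tensorInl : A →ₐc[R] A ⊗[R] H :=
  (Bialgebra.TensorProduct.map (.id R A) (Bialgebra.unitBialgHom R H)).comp
    ((Bialgebra.TensorProduct.rid R R A).symm : A →ₐc[R] A ⊗[R] R)

/-- The inclusion `h ↦ 1 ⊗ h` of the second factor of a tensor product of bialgebras. -/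
def tensorInr : H →ₐc[R] A ⊗[R] H :=
  (Bialgebra.TensorProduct.map (Bialgebra.unitBialgHom R A) (.id R H)).comp
    ((Bialgebra.TensorProduct.lid R H).symm : H →ₐc[R] R ⊗[R] H)

variable {A H}

@[simp] theorem tensorInl_apply (a : A) : tensorInl R A H a = a ⊗ₜ 1 := by
  change a ⊗ₜ[R] (Bialgebra.unitBialgHom R H 1) = _
  rw [map_one]

@[simp] theorem tensorInr_apply (h : H) : tensorInr R A H h = 1 ⊗ₜ h := by
  change (Bialgebra.unitBialgHom R A 1) ⊗ₜ[R] h = _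
  rw [map_one]

end Inclusions

section Factorization

variable {R A H E : Type*} [CommSemiring R] [Semiring A] [Bialgebra R A] [Semiring H]
  [Bialgebra R H] [Semiring E] [Bialgebra R E]

/-- The coalgebra map `A ⊗ H → E`, `a ⊗ h ↦ i(a) j(h)`, attached to a pair of bialgebra maps. -/
def mulHom (i : A →ₐc[R] E) (j : H →ₐc[R] E) : A ⊗[R] H →ₗc[R] E :=
  (Bialgebra.mulCoalgHom R E).comp (Coalgebra.TensorProduct.map (i : A →ₗc[R] E) (j : H →ₗc[R] E))

@[simp] theorem mulHom_tmul (i : A →ₐc[R] E) (j : H →ₐc[R] E) (a : A) (h : H) :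
    mulHom i j (a ⊗ₜ h) = i a * j h := rfl

/-- The bialgebra maps `i : A → E` and `j : H → E` form a factorization of `E`: every element of
`E` is uniquely of the form `∑ i(a) j(h)`, a sum over a tensor in `A ⊗ H`. -/
def IsFactorization (i : A →ₐc[R] E) (j : H →ₐc[R] E) : Prop :=
  Function.Bijective (mulHom i j)

namespace IsFactorization

variable {i : A →ₐc[R] E} {j : H →ₐc[R] E}

theorem linearMap_ext (hm : IsFactorization i j) {V : Type*} [AddCommMonoid V] [Module R V]
    {f g : E →ₗ[R] V} (hfg : ∀ a h, f (i a * j h) = g (i a * j h)) : f = g := by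
  have : f ∘ₗ (mulHom i j : A ⊗[R] H →ₗ[R] E) = g ∘ₗ (mulHom i j : A ⊗[R] H →ₗ[R] E) := by
    ext a h; exact hfg a h
  ext e
  obtain ⟨t, rfl⟩ := hm.2 e
  exact LinearMap.congr_fun this t

variable (hm : IsFactorization i j)

/-- The multiplication map of a factorization, as an isomorphism of coalgebras. -/
def mulEquiv : A ⊗[R] H ≃ₗc[R] E := CoalgEquiv.ofBijective hm

@[simp] theorem mulEquiv_tmul (a : A) (h : H) : hm.mulEquiv (a ⊗ₜ h) = i a * j h := rfl

@[simp] theorem mulEquiv_symm_mul (a : A) (h : H) : hm.mulEquiv.symm (i a * j h) = a ⊗ₜ h :=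
  hm.mulEquiv.symm_apply_apply (a ⊗ₜ h)

/-- The coalgebra projection `E → A`, `i(a) j(h) ↦ ε(h) a`. -/
def fst : E →ₗc[R] A := (tensorFst R A H).comp (hm.mulEquiv.symm : E →ₗc[R] A ⊗[R] H)

/-- The coalgebra projection `E → H`, `i(a) j(h) ↦ ε(a) h`. -/
def snd : E →ₗc[R] H := (tensorSnd R A H).comp (hm.mulEquiv.symm : E →ₗc[R] A ⊗[R] H)

@[simp] theorem fst_mul (a : A) (h : H) : hm.fst (i a * j h) = counit (R := R) h • a :=
  congrArg (tensorFst R A H) (hm.mulEquiv_symm_mul a h)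

@[simp] theorem snd_mul (a : A) (h : H) : hm.snd (i a * j h) = counit (R := R) a • h :=
  congrArg (tensorSnd R A H) (hm.mulEquiv_symm_mul a h)

@[simp] theorem fst_left (a : A) : hm.fst (i a) = a := by simpa using hm.fst_mul a 1

@[simp] theorem snd_left (a : A) : hm.snd (i a) = counit (R := R) a • (1 : H) := by
  simpa using hm.snd_mul a 1

@[simp] theorem fst_right (h : H) : hm.fst (j h) = counit (R := R) h • (1 : A) := by
  simpa using hm.fst_mul 1 h

@[simp] theorem snd_right (h : H) : hm.snd (j h) = h := by simpa using hm.snd_mul 1 h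

theorem fst_left_mul (a : A) (e : E) : hm.fst (i a * e) = a * hm.fst e := by
  refine LinearMap.congr_fun (hm.linearMap_ext
    (f := (hm.fst : E →ₗ[R] A) ∘ₗ LinearMap.mulLeft R (i a))
    (g := LinearMap.mulLeft R a ∘ₗ (hm.fst : E →ₗ[R] A)) fun b h => ?_) e
  simp [← mul_assoc, ← map_mul]

theorem fst_mul_right (e : E) (h : H) : hm.fst (e * j h) = counit (R := R) h • hm.fst e := by
  refine LinearMap.congr_fun (hm.linearMap_ext
    (f := (hm.fst : E →ₗ[R] A) ∘ₗ LinearMap.mulRight R (j h))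
    (g := counit (R := R) h • (hm.fst : E →ₗ[R] A)) fun b h' => ?_) e
  simp [mul_assoc, ← map_mul, smul_smul, mul_comm (counit (R := R) h)]

theorem snd_mul_right (e : E) (h : H) : hm.snd (e * j h) = hm.snd e * h := by
  refine LinearMap.congr_fun (hm.linearMap_ext
    (f := (hm.snd : E →ₗ[R] H) ∘ₗ LinearMap.mulRight R (j h))
    (g := LinearMap.mulRight R h ∘ₗ (hm.snd : E →ₗ[R] H)) fun b h' => ?_) e
  simp [mul_assoc, ← map_mul]

theorem snd_left_mul (a : A) (e : E) : hm.snd (i a * e) = counit (R := R) a • hm.snd e := by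
  refine LinearMap.congr_fun (hm.linearMap_ext
    (f := (hm.snd : E →ₗ[R] H) ∘ₗ LinearMap.mulLeft R (i a))
    (g := counit (R := R) a • (hm.snd : E →ₗ[R] H)) fun b h' => ?_) e
  simp [← mul_assoc, ← map_mul, smul_smul]

theorem fst_mul_eq (e f : E) : hm.fst (e * f) = hm.fst (e * i (hm.fst f)) := by
  refine LinearMap.congr_fun (hm.linearMap_ext
    (f := (hm.fst : E →ₗ[R] A) ∘ₗ LinearMap.mulLeft R e)
    (g := (hm.fst : E →ₗ[R] A) ∘ₗ LinearMap.mulLeft R e ∘ₗ (i : A →ₗ[R] E) ∘ₗ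
      (hm.fst : E →ₗ[R] A)) fun b h => ?_) f
  simp [← mul_assoc, fst_mul_right]

theorem snd_mul_eq (e f : E) : hm.snd (e * f) = hm.snd (j (hm.snd e) * f) := by
  refine LinearMap.congr_fun (hm.linearMap_ext
    (f := (hm.snd : E →ₗ[R] H) ∘ₗ LinearMap.mulRight R f)
    (g := (hm.snd : E →ₗ[R] H) ∘ₗ LinearMap.mulRight R f ∘ₗ (j : H →ₗ[R] E) ∘ₗ
      (hm.snd : E →ₗ[R] H)) fun b h => ?_) e
  simp [mul_assoc, snd_left_mul]

theorem map_fst_snd_comul (e : E) :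
    map (hm.fst : E →ₗ[R] A) (hm.snd : E →ₗ[R] H) (comul e) = hm.mulEquiv.symm e := by
  rw [fst, snd, CoalgHom.comp_toLinearMap, CoalgHom.comp_toLinearMap, map_comp,
    LinearMap.comp_apply, CoalgHomClass.map_comp_comul_apply]
  exact map_tensorFst_tensorSnd_comul R _

theorem map_snd_fst_comul (e : E) :
    map (hm.snd : E →ₗ[R] H) (hm.fst : E →ₗ[R] A) (comul e) =
      TensorProduct.comm R A H (hm.mulEquiv.symm e) := by
  rw [fst, snd, CoalgHom.comp_toLinearMap, CoalgHom.comp_toLinearMap, map_comp,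
    LinearMap.comp_apply, CoalgHomClass.map_comp_comul_apply]
  exact map_tensorSnd_tensorFst_comul R _

/-- The left action `h ▷ a` of `H` on `A`, as a map out of `H ⊗ A`: the first component of
`j(h) i(a)`. -/
def act : H ⊗[R] A →ₗc[R] A := hm.fst.comp (mulHom j i)

/-- The right action `h ◁ a` of `A` on `H`, as a map out of `H ⊗ A`: the second component of
`j(h) i(a)`. -/
def coact : H ⊗[R] A →ₗc[R] H := hm.snd.comp (mulHom j i)

theorem act_tmul (h : H) (a : A) : hm.act (h ⊗ₜ a) = hm.fst (j h * i a) := rfl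

theorem coact_tmul (h : H) (a : A) : hm.coact (h ⊗ₜ a) = hm.snd (j h * i a) := rfl

theorem map_act_coact_comul (t : H ⊗[R] A) :
    map (hm.act : H ⊗[R] A →ₗ[R] A) (hm.coact : H ⊗[R] A →ₗ[R] H) (comul t) =
      hm.mulEquiv.symm (mulHom j i t) := by
  rw [act, coact, CoalgHom.comp_toLinearMap, CoalgHom.comp_toLinearMap, map_comp,
    LinearMap.comp_apply, CoalgHomClass.map_comp_comul_apply, map_fst_snd_comul]

theorem map_coact_act_comul (t : H ⊗[R] A) :
    map (hm.coact : H ⊗[R] A →ₗ[R] H) (hm.act : H ⊗[R] A →ₗ[R] A) (comul t) =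
      TensorProduct.comm R A H (hm.mulEquiv.symm (mulHom j i t)) := by
  rw [act, coact, CoalgHom.comp_toLinearMap, CoalgHom.comp_toLinearMap, map_comp,
    LinearMap.comp_apply, CoalgHomClass.map_comp_comul_apply, map_snd_fst_comul]

theorem act_mul (h : H) (a b : A) : hm.act (h ⊗ₜ (a * b)) =
    LinearMap.mul' R A (map (hm.act : H ⊗[R] A →ₗ[R] A)
      ((hm.act : H ⊗[R] A →ₗ[R] A) ∘ₗ (TensorProduct.mk R H A).flip b ∘ₗ
        (hm.coact : H ⊗[R] A →ₗ[R] H)) (comul (h ⊗ₜ[R] a))) := by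
  have key : (hm.fst : E →ₗ[R] A) ∘ₗ LinearMap.mulRight R (i b) = LinearMap.mul' R A ∘ₗ
      map .id ((hm.act : H ⊗[R] A →ₗ[R] A) ∘ₗ (TensorProduct.mk R H A).flip b) ∘ₗ
        (hm.mulEquiv.symm : E →ₗ[R] A ⊗[R] H) :=
    hm.linearMap_ext fun a' h' => by simp [mul_assoc, fst_left_mul, act_tmul]
  rw [← LinearMap.id_comp (hm.act : H ⊗[R] A →ₗ[R] A), ← LinearMap.comp_assoc, map_comp,
    LinearMap.id_comp, LinearMap.comp_apply, map_act_coact_comul, act_tmul, map_mul i, ← mul_assoc]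
  exact LinearMap.congr_fun key _

theorem mul_coact (g h : H) (a : A) : hm.coact ((g * h) ⊗ₜ a) =
    LinearMap.mul' R H (map
      ((hm.coact : H ⊗[R] A →ₗ[R] H) ∘ₗ TensorProduct.mk R H A g ∘ₗ (hm.act : H ⊗[R] A →ₗ[R] A))
      (hm.coact : H ⊗[R] A →ₗ[R] H) (comul (h ⊗ₜ[R] a))) := by
  have key : (hm.snd : E →ₗ[R] H) ∘ₗ LinearMap.mulLeft R (j g) = LinearMap.mul' R H ∘ₗ
      map ((hm.coact : H ⊗[R] A →ₗ[R] H) ∘ₗ TensorProduct.mk R H A g) .id ∘ₗ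
        (hm.mulEquiv.symm : E →ₗ[R] A ⊗[R] H) :=
    hm.linearMap_ext fun a' h' => by simp [← mul_assoc, snd_mul_right, coact_tmul]
  rw [← LinearMap.id_comp (hm.coact : H ⊗[R] A →ₗ[R] H), ← LinearMap.comp_assoc, map_comp,
    LinearMap.id_comp, LinearMap.comp_apply, map_act_coact_comul, coact_tmul, map_mul j, mul_assoc]
  exact LinearMap.congr_fun key _

variable {E' : Type*} [Semiring E'] [Bialgebra R E']

theorem map_bialgEquiv (hm : IsFactorization i j) (e : E ≃ₐc[R] E') :
    IsFactorization ((e : E →ₐc[R] E').comp i) ((e : E →ₐc[R] E').comp j) := by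
  have comp_mulHom : (mulHom ((e : E →ₐc[R] E').comp i) ((e : E →ₐc[R] E').comp j) :
      A ⊗[R] H →ₗ[R] E') = (e : E →ₗ[R] E') ∘ₗ (mulHom i j : A ⊗[R] H →ₗ[R] E) := by
    ext a h; simp
  have : ⇑(mulHom ((e : E →ₐc[R] E').comp i) ((e : E →ₐc[R] E').comp j)) = e ∘ mulHom i j :=
    funext fun t => LinearMap.congr_fun comp_mulHom t
  rw [IsFactorization, this]
  exact e.toEquiv.bijective.comp hm

theorem nonempty_bialgEquiv (hm : IsFactorization i j) {i' : A →ₐc[R] E'} {j' : H →ₐc[R] E'}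
    (hm' : IsFactorization i' j') (f : E →ₐ[R] E') (hi : ∀ a, f (i a) = i' a)
    (hj : ∀ h, f (j h) = j' h) : Nonempty (E ≃ₐc[R] E') := by
  have apply_eq (e : E) : f e = hm'.mulEquiv (hm.mulEquiv.symm e) :=
    LinearMap.congr_fun (hm.linearMap_ext (f := f.toLinearMap)
      (g := (hm'.mulEquiv : A ⊗[R] H →ₗ[R] E') ∘ₗ (hm.mulEquiv.symm : E →ₗ[R] A ⊗[R] H))
      fun a h => by simp [hi, hj]) e
  refine ⟨{ hm.mulEquiv.symm.trans hm'.mulEquiv with map_mul' := fun x y => ?_ }⟩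
  change hm'.mulEquiv (hm.mulEquiv.symm (x * y)) =
    hm'.mulEquiv (hm.mulEquiv.symm x) * hm'.mulEquiv (hm.mulEquiv.symm y)
  simp only [← apply_eq, map_mul]

end IsFactorization

theorem isFactorization_tensorInl_tensorInr :
    IsFactorization (tensorInl R A H) (tensorInr R A H) := by
  have : (mulHom (tensorInl R A H) (tensorInr R A H) : A ⊗[R] H →ₗ[R] A ⊗[R] H) = .id := by
    ext; simp
  have mulHom_eq : ⇑(mulHom (tensorInl R A H) (tensorInr R A H)) = id :=
    funext fun t => LinearMap.congr_fun this t
  rw [IsFactorization, mulHom_eq]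
  exact Function.bijective_id

end Factorization

/-! ### Bicrossed products -/

section Bicrossed

variable {k A H E : Type*} [Field k] [Ring A] [HopfAlgebra k A] [Ring H] [HopfAlgebra k H]
  [Ring E] [HopfAlgebra k E]

namespace MatchedPair

variable (M : MatchedPair k A H)

theorem prod_one_left (a b : A) (g : H) : M.prod a 1 b g = (a * b) ⊗ₜ g := by
  have key : map (LinearMap.mulLeft k a ∘ₗ (M.act : H ⊗[k] A →ₗ[k] A))
        (LinearMap.mulRight k g ∘ₗ (M.coact : H ⊗[k] A →ₗ[k] H)) ∘ₗ
        (AlgebraTensorModule.tensorTensorTensorComm k k k k H H A A).toLinearMap ∘ₗ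
        TensorProduct.mk k (H ⊗[k] H) (A ⊗[k] A) (1 ⊗ₜ 1) =
      (TensorProduct.mk k A H).flip g ∘ₗ LinearMap.mulLeft k a ∘ₗ
        (TensorProduct.rid k A).toLinearMap ∘ₗ counit.lTensor A := by
    ext x y
    simp [M.one_act, M.one_coact]
  rw [MatchedPair.prod, comul_tmul, Bialgebra.comul_one, Algebra.TensorProduct.one_def]
  exact (LinearMap.congr_fun key _).trans (by simp)

theorem prod_one_right (a : A) (h g : H) : M.prod a h 1 g = a ⊗ₜ (h * g) := by
  have key : map (LinearMap.mulLeft k a ∘ₗ (M.act : H ⊗[k] A →ₗ[k] A))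
        (LinearMap.mulRight k g ∘ₗ (M.coact : H ⊗[k] A →ₗ[k] H)) ∘ₗ
        (AlgebraTensorModule.tensorTensorTensorComm k k k k H H A A).toLinearMap ∘ₗ
        (TensorProduct.mk k (H ⊗[k] H) (A ⊗[k] A)).flip (1 ⊗ₜ 1) =
      TensorProduct.mk k A H a ∘ₗ LinearMap.mulRight k g ∘ₗ
        (TensorProduct.lid k H).toLinearMap ∘ₗ counit.rTensor H := by
    ext x y
    simp [M.act_one, M.coact_one, smul_tmul]
  rw [MatchedPair.prod, comul_tmul, Bialgebra.comul_one, Algebra.TensorProduct.one_def]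
  exact (LinearMap.congr_fun key _).trans (by simp)

end MatchedPair

namespace IsFactorization

variable {i : A →ₐc[k] E} {j : H →ₐc[k] E}

/-- The matched pair of the actions `▷` and `◁` defined by a factorization. -/
def matchedPair (hm : IsFactorization i j) : MatchedPair k A H where
  act := hm.act
  coact := hm.coact
  one_act a := by simp [act_tmul]
  mul_act g h a := by
    simp only [act_tmul, map_mul j, mul_assoc]
    exact hm.fst_mul_eq (j g) (j h * i a)
  coact_one h := by simp [coact_tmul]
  coact_mul h a b := by
    simp only [coact_tmul, map_mul i, ← mul_assoc]
    exact hm.snd_mul_eq (j h * i a) (i b)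
  act_one h := by simp [act_tmul]
  one_coact a := by simp [coact_tmul]
  act_mul := hm.act_mul
  mul_coact := hm.mul_coact
  compat h a := by rw [hm.map_coact_act_comul, hm.map_act_coact_comul]

theorem isBicrossedProduct (hm : IsFactorization i j) : IsBicrossedProduct k A H E := by
  refine ⟨hm.matchedPair, hm.mulEquiv, by simp, fun a h b g => ?_⟩
  have key : LinearMap.mulLeft k (i a) ∘ₗ LinearMap.mulRight k (j g) =
      (hm.mulEquiv : A ⊗[k] H →ₗ[k] E) ∘ₗ map (LinearMap.mulLeft k a) (LinearMap.mulRight k g) ∘ₗ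
        (hm.mulEquiv.symm : E →ₗ[k] A ⊗[k] H) :=
    hm.linearMap_ext fun a' h' => by simp [mul_assoc]
  calc i a * j h * (i b * j g) = i a * ((j h * i b) * j g) := by simp only [mul_assoc]
    _ = hm.mulEquiv (map (LinearMap.mulLeft k a) (LinearMap.mulRight k g)
          (hm.mulEquiv.symm (mulHom j i (h ⊗ₜ b)))) := LinearMap.congr_fun key _
    _ = hm.mulEquiv (hm.matchedPair.prod a h b g) := by
        rw [← hm.map_act_coact_comul, ← LinearMap.comp_apply (map _ _), ← map_comp]
        rfl

end IsFactorization

theorem factorizesThrough_iff : FactorizesThrough k A H E ↔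
    ∃ (i : A →ₐc[k] E) (j : H →ₐc[k] E), IsFactorization i j := by
  have lift_eq (i : A →ₐc[k] E) (j : H →ₐc[k] E) :
      TensorProduct.lift ((LinearMap.mul k E).compl₁₂ (i : A →ₗ[k] E) (j : H →ₗ[k] E)) =
        mulHom i j := by ext; rfl
  simp only [FactorizesThrough, lift_eq]
  exact ⟨fun ⟨i, j, _, _, hm⟩ => ⟨i, j, hm⟩, fun ⟨i, j, hm⟩ => ⟨i, j,
    Function.LeftInverse.injective hm.fst_left, Function.LeftInverse.injective hm.snd_right, hm⟩⟩

theorem IsBicrossedProduct.factorizesThrough (hE : IsBicrossedProduct k A H E) :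
    FactorizesThrough k A H E := by
  obtain ⟨M, φ, hone, hmul⟩ := hE
  let i : A →ₐc[k] E :=
    { (φ : A ⊗[k] H →ₗc[k] E).comp (tensorInl k A H : A →ₗc[k] A ⊗[k] H) with
      map_one' := by simpa using hone
      map_mul' := fun a b => by simpa [M.prod_one_left] using (hmul a 1 b 1).symm }
  let j : H →ₐc[k] E :=
    { (φ : A ⊗[k] H →ₗc[k] E).comp (tensorInr k A H : H →ₗc[k] A ⊗[k] H) with
      map_one' := by simpa using hone
      map_mul' := fun a b => by simpa [M.prod_one_right] using (hmul 1 a 1 b).symm }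
  have hi (a : A) : i a = φ (a ⊗ₜ 1) := congrArg φ (tensorInl_apply k a)
  have hj (h : H) : j h = φ (1 ⊗ₜ h) := congrArg φ (tensorInr_apply k h)
  have mulHom_eq : (mulHom i j : A ⊗[k] H →ₗ[k] E) = (φ : A ⊗[k] H →ₗ[k] E) := by
    ext a h
    simpa [hi, hj, M.prod_one_left] using hmul a 1 1 h
  refine factorizesThrough_iff.2 ⟨i, j, ?_⟩
  rw [IsFactorization, show ⇑(mulHom i j) = ⇑φ from
    funext fun t => LinearMap.congr_fun mulHom_eq t]
  exact φ.toEquiv.bijective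

theorem isBicrossedProduct_iff_factorizesThrough :
    IsBicrossedProduct k A H E ↔ FactorizesThrough k A H E := by
  refine ⟨IsBicrossedProduct.factorizesThrough, fun hE => ?_⟩
  obtain ⟨i, j, hm⟩ := factorizesThrough_iff.1 hE
  exact hm.isBicrossedProduct

theorem FactorizesThrough.of_bialgEquiv {E' : Type*} [Ring E'] [HopfAlgebra k E']
    (hE : FactorizesThrough k A H E) (e : E' ≃ₐc[k] E) : FactorizesThrough k A H E' := by
  obtain ⟨i, j, hm⟩ := factorizesThrough_iff.1 hE
  exact factorizesThrough_iff.2 ⟨_, _, hm.map_bialgEquiv e.symm⟩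

end Bicrossed

/-! ### Interchanging the factors -/

section Antipode

open HopfAlgebra (antipode)

open scoped Coalgebra

variable {R A H E : Type*} [CommSemiring R] [Semiring A] [HopfAlgebra R A] [Semiring H]
  [HopfAlgebra R H] [Semiring E] [HopfAlgebra R E]

/-- Both sides are convolution inverses of `f`. -/
theorem bialgHom_antipode (f : A →ₐc[R] E) (a : A) : f (antipode R a) = antipode R (f a) := by
  let F : WithConv (A →ₗ[R] E) := WithConv.toConv (f : A →ₗ[R] E)
  let L : WithConv (A →ₗ[R] E) := WithConv.toConv ((f : A →ₗ[R] E) ∘ₗ antipode R)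
  let S : WithConv (A →ₗ[R] E) := WithConv.toConv (antipode R ∘ₗ (f : A →ₗ[R] E))
  have mul_F : L * F = 1 := by
    ext c
    rw [(ℛ R c).convMul_apply]
    simpa [F, L, ← map_mul, ← map_sum, HopfAlgebra.sum_antipode_mul_eq_algebraMap_counit]
      using AlgHomClass.commutes f _
  have F_mul : F * S = 1 := by
    ext c
    rw [(ℛ R c).convMul_apply]
    simpa [F, S] using
      HopfAlgebra.sum_mul_antipode_eq_algebraMap_counit ((ℛ R c).induced (f : A →ₗc[R] E))
  exact LinearMap.congr_fun
    (congrArg WithConv.ofConv (left_inv_eq_right_inv mul_F F_mul)) a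

theorem antipode_iterate_two_mul (n : ℕ) (x y : E) :
    (antipode R)^[2 * n] (x * y) = (antipode R)^[2 * n] x * (antipode R)^[2 * n] y := by
  have sq_mul : Function.Semiconj₂ (⇑(antipode R (A := E)))^[2] (· * ·) (· * ·) := fun x y => by
    simp [HopfAlgebra.antipode_mul_antidistrib]
  rw [Function.iterate_mul]
  exact sq_mul.iterate n x y

theorem antipode_bijective_of_iterate_eq_id {n : ℕ} (hn : n ≠ 0)
    (hA : (⇑(antipode R (A := A)))^[n] = id) : Function.Bijective (antipode R (A := A)) := by
  obtain ⟨m, rfl⟩ := Nat.exists_eq_succ_of_ne_zero hn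
  constructor
  · refine Function.Injective.of_comp (f := (antipode R)^[m]) ?_
    rw [← Function.iterate_succ, hA]
    exact Function.injective_id
  · refine Function.Surjective.of_comp (g := (antipode R)^[m]) ?_
    rw [← Function.iterate_succ', hA]
    exact Function.surjective_id

namespace IsFactorization

variable {i : A →ₐc[R] E} {j : H →ₐc[R] E} {n : ℕ}

theorem antipode_iterate_eq_id (hm : IsFactorization i j)
    (hA : (⇑(antipode R (A := A)))^[2 * n] = id) (hH : (⇑(antipode R (A := H)))^[2 * n] = id) :
    (⇑(antipode R (A := E)))^[2 * n] = id := by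
  have hi : Function.Semiconj i (antipode R) (antipode R) := bialgHom_antipode i
  have hj : Function.Semiconj j (antipode R) (antipode R) := bialgHom_antipode j
  have : antipode R ^ (2 * n) = (LinearMap.id : E →ₗ[R] E) := hm.linearMap_ext fun a h => by
    rw [Module.End.pow_apply, antipode_iterate_two_mul, ← hi.iterate_right, ← hj.iterate_right,
      hA, hH]
    rfl
  rw [← Module.End.coe_pow, this]
  rfl

/-- The antipode of `E` maps `i(a) j(h)` to `j(S h) i(S a)`. -/
theorem swap (hm : IsFactorization i j) (hn : n ≠ 0)
    (hA : (⇑(antipode R (A := A)))^[2 * n] = id) (hH : (⇑(antipode R (A := H)))^[2 * n] = id) :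
    IsFactorization j i := by
  have hn' : 2 * n ≠ 0 := by omega
  let σA := LinearEquiv.ofBijective (antipode R) (antipode_bijective_of_iterate_eq_id hn' hA)
  let σH := LinearEquiv.ofBijective (antipode R) (antipode_bijective_of_iterate_eq_id hn' hH)
  let σE := LinearEquiv.ofBijective (antipode R)
    (antipode_bijective_of_iterate_eq_id hn' (hm.antipode_iterate_eq_id hA hH))
  have conj : (mulHom j i : H ⊗[R] A →ₗ[R] E) ∘ₗ
      (TensorProduct.comm R A H ≪≫ₗ TensorProduct.congr σH σA).toLinearMap =
      (hm.mulEquiv.toLinearEquiv ≪≫ₗ σE).toLinearMap := by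
    ext a h
    simp [σA, σH, σE, bialgHom_antipode, HopfAlgebra.antipode_mul_antidistrib]
  have bijective_comp := (hm.mulEquiv.toLinearEquiv ≪≫ₗ σE).bijective
  rw [← LinearEquiv.coe_toLinearMap, ← conj, LinearMap.coe_comp] at bijective_comp
  exact ((TensorProduct.comm R A H ≪≫ₗ TensorProduct.congr σH σA).bijective.of_comp_iff _).1
    bijective_comp

end IsFactorization

theorem FactorizesThrough.swap {k A H E : Type*} [Field k] [Ring A] [HopfAlgebra k A] [Ring H]
    [HopfAlgebra k H] [Ring E] [HopfAlgebra k E] (hE : FactorizesThrough k A H E) {n : ℕ}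
    (hn : n ≠ 0) (hA : (⇑(antipode k (A := A)))^[2 * n] = id)
    (hH : (⇑(antipode k (A := H)))^[2 * n] = id) : FactorizesThrough k H A E := by
  obtain ⟨i, j, hm⟩ := factorizesThrough_iff.1 hE
  exact factorizesThrough_iff.2 ⟨j, i, hm.swap hn hA hH⟩

end Antipode

/-! ### Sweedler's Hopf algebra -/

theorem submodule_eq_top_of_mul_mem {R P : Type*} [CommSemiring R] [Semiring P] [Algebra R P]
    {s : Set P} (hs : Algebra.adjoin R s = ⊤) {W : Submodule R P} (one_mem : (1 : P) ∈ W)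
    (mul_mem : ∀ x ∈ s, ∀ w ∈ W, x * w ∈ W) : W = ⊤ := by
  refine eq_top_iff.2 fun x _ => ?_
  suffices ∀ x ∈ Algebra.adjoin R s, ∀ w ∈ W, x * w ∈ W by
    simpa using this x (hs ▸ Algebra.mem_top) 1 one_mem
  intro x hx
  induction hx using Algebra.adjoin_induction with
  | mem x hx => exact mul_mem x hx
  | algebraMap r => exact fun w hw => by rw [← Algebra.smul_def]; exact W.smul_mem r hw
  | add x y _ _ hx hy => exact fun w hw => by rw [add_mul]; exact W.add_mem (hx w hw) (hy w hw)
  | mul x y _ _ hx hy => exact fun w hw => by rw [mul_assoc]; exact hx _ (hy w hw)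

theorem semiconjBy_of_adjoin {R P Q : Type*} [CommSemiring R] [Semiring P] [Algebra R P]
    [Semiring Q] [Algebra R Q] {s : Set P} (hs : Algebra.adjoin R s = ⊤) {φ ψ : P →ₐ[R] Q} {x : Q}
    (h : ∀ a ∈ s, SemiconjBy x (φ a) (ψ a)) (a : P) : SemiconjBy x (φ a) (ψ a) := by
  let W : Submodule R P := LinearMap.eqLocus (LinearMap.mulLeft R x ∘ₗ φ.toLinearMap)
    (LinearMap.mulRight R x ∘ₗ ψ.toLinearMap)
  have hW : W = ⊤ := submodule_eq_top_of_mul_mem hs (by simp [W]) fun a ha b hb => by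
    change x * φ (a * b) = ψ (a * b) * x
    rw [map_mul, map_mul]
    exact (h a ha).mul_right hb
  exact (hW ▸ Submodule.mem_top : a ∈ W)

theorem antipode_iterate_eq_id_of_adjoin {R A : Type*} [CommSemiring R] [Semiring A]
    [HopfAlgebra R A] {s : Set A} (hs : Algebra.adjoin R s = ⊤) {n : ℕ}
    (h : ∀ x ∈ s, (HopfAlgebra.antipode R)^[2 * n] x = x) :
    (⇑(HopfAlgebra.antipode R (A := A)))^[2 * n] = id := by
  have one : (HopfAlgebra.antipode R)^[2 * n] (1 : A) = 1 :=
    Function.iterate_fixed HopfAlgebra.antipode_one _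
  let T : A →ₐ[R] A := AlgHom.ofLinearMap (HopfAlgebra.antipode R ^ (2 * n))
    (by rwa [Module.End.pow_apply])
    (fun x y => by simpa only [Module.End.pow_apply] using antipode_iterate_two_mul n x y)
  have hT : T = AlgHom.id R A := AlgHom.ext_of_adjoin_eq_top hs fun x hx => by
    simpa [T, Module.End.pow_apply] using h x hx
  funext x
  simpa [T, Module.End.pow_apply] using DFunLike.congr_fun hT x

namespace H4

open HopfAlgebra (antipode)

variable {k : Type*} [Field k]

theorem rel (k : Type*) [Field k] : HopfGen.Rel4 (G k) (X k) := rel4 k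

theorem adjoin_eq_top : Algebra.adjoin k {G k, X k} = ⊤ := by
  refine top_le_iff.1 ((HopfGen.adjoin_ringQuot (Rel k)).symm.le.trans (Algebra.adjoin_mono ?_))
  rintro _ ⟨(_ | _), rfl⟩
  exacts [Or.inl rfl, Or.inr rfl]

section Lift

variable {B : Type*} [Ring B] [Algebra k B] {a b : B} (R : HopfGen.Rel4 a b)

/-- The algebra map out of Sweedler's algebra given by a pair satisfying its relations. -/
def liftHom : H4 k →ₐ[k] B :=
  lift k (fun | .G => a | .X => b) R

@[simp] theorem liftHom_G : liftHom R (G k) = a := lift_gen k _ R .G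

@[simp] theorem liftHom_X : liftHom R (X k) = b := lift_gen k _ R .X

theorem hom_ext {φ ψ : H4 k →ₐ[k] B} (hG : φ (G k) = ψ (G k)) (hX : φ (X k) = ψ (X k)) :
    φ = ψ := by
  refine AlgHom.ext_of_adjoin_eq_top adjoin_eq_top ?_
  rintro _ (rfl | rfl)
  exacts [hG, hX]

end Lift

@[simp] theorem counit_G : counit (R := k) (G k) = 1 := lift_gen k (counitGen k) (rel4_counit k) .G

@[simp] theorem counit_X : counit (R := k) (X k) = 0 := lift_gen k (counitGen k) (rel4_counit k) .X

theorem isGroupLikeElem_G : IsGroupLikeElem k (G k) := ⟨counit_G, comul_G k⟩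

theorem antipode_G : antipode k (G k) = G k :=
  congrArg MulOpposite.unop (lift_gen k (antipodeGen k) (rel4 k).op .G)

theorem antipode_antipode_X : antipode k (antipode k (X k)) = -X k := by
  rw [antipode_X, HopfAlgebra.antipode_mul_antidistrib, antipode_X, antipode_G, mul_assoc,
    (rel k).XG, mul_neg, ← mul_assoc, (rel k).GG, one_mul]

theorem antipode_iterate_four : (⇑(antipode k (A := H4 k)))^[2 * 2] = id := by
  refine antipode_iterate_eq_id_of_adjoin adjoin_eq_top ?_
  rintro _ (rfl | rfl)
  · simp [antipode_G]
  · simp [antipode_antipode_X]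

/-- A bialgebra map out of Sweedler's Hopf algebra, given by the images of the generators. -/
def liftBialgHom {E : Type*} [Ring E] [Bialgebra k E] {a b : E} (R : HopfGen.Rel4 a b)
    (ha : IsGroupLikeElem k a) (comul_b : comul (R := k) b = HopfGen.comulX k a b)
    (counit_b : counit (R := k) b = 0) : H4 k →ₐc[k] E :=
  BialgHom.ofAlgHom (liftHom R)
    (hom_ext (by simp [ha.counit_eq_one]) (by simp [counit_b]))
    (hom_ext (by simp [ha.comul_eq_tmul_self, comul_G])
      (by simp [comul_b, comul_X, HopfGen.comulX]))

/-- The left regular representation of Sweedler's algebra in the basis `1, G, X, GX`. -/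
def regularRep (k : Type*) [Field k] : H4 k →ₐ[k] Matrix (Fin 4) (Fin 4) k :=
  liftHom (a := !![0, 1, 0, 0; 1, 0, 0, 0; 0, 0, 0, 1; 0, 0, 1, 0])
    (b := !![0, 0, 0, 0; 0, 0, 0, 0; 1, 0, 0, 0; 0, -1, 0, 0]) (by
      constructor <;> ext i j <;> fin_cases i <;> fin_cases j <;>
        simp [Matrix.mul_apply, Fin.sum_univ_four])

theorem linearIndependent_monomials : LinearIndependent k ![1, G k, X k, G k * X k] := by
  let firstColumn : H4 k →ₗ[k] Fin 4 → k :=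
    LinearMap.pi fun i => Matrix.entryLinearMap k k i 0 ∘ₗ (regularRep k).toLinearMap
  refine LinearIndependent.of_comp firstColumn ?_
  convert (Pi.basisFun k (Fin 4)).linearIndependent using 1
  ext m i
  fin_cases m <;> fin_cases i <;>
    simp [firstColumn, regularRep]

theorem span_monomials : Submodule.span k (Set.range ![1, G k, X k, G k * X k]) = ⊤ := by
  have mem (m : Fin 4) : ![1, G k, X k, G k * X k] m ∈
      Submodule.span k (Set.range ![1, G k, X k, G k * X k]) := Submodule.subset_span ⟨m, rfl⟩
  refine submodule_eq_top_of_mul_mem adjoin_eq_top (mem 0) fun x hx w hw => ?_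
  induction hw using Submodule.span_induction with
  | zero => simp
  | add a b _ _ ha hb => rw [mul_add]; exact Submodule.add_mem _ ha hb
  | smul r a _ ha => rw [mul_smul_comm]; exact Submodule.smul_mem _ r ha
  | mem w hw =>
    obtain ⟨m, rfl⟩ := hw
    have XGX : X k * (G k * X k) = 0 := by
      rw [← mul_assoc, (rel k).XG, neg_mul, mul_assoc, (rel k).XX, mul_zero, neg_zero]
    have GGX : G k * (G k * X k) = X k := by rw [← mul_assoc, (rel k).GG, one_mul]
    rcases hx with (rfl | rfl) <;> fin_cases m
    · simpa using mem 1
    · simpa [(rel k).GG] using mem 0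
    · exact mem 3
    · simpa [GGX] using mem 2
    · simpa using mem 2
    · simpa [(rel k).XG] using mem 3
    · simp [(rel k).XX]
    · simp [XGX]

/-- The basis `1, G, X, GX` of Sweedler's algebra. -/
def basis (k : Type*) [Field k] : Module.Basis (Fin 4) k (H4 k) :=
  .mk linearIndependent_monomials span_monomials.ge

@[simp] theorem repr_one : (basis k).repr 1 = Finsupp.single 0 1 := by
  simpa [basis] using (basis k).repr_self 0

@[simp] theorem repr_G : (basis k).repr (G k) = Finsupp.single 1 1 := by
  simpa [basis] using (basis k).repr_self 1

@[simp] theorem repr_X : (basis k).repr (X k) = Finsupp.single 2 1 := by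
  simpa [basis] using (basis k).repr_self 2

@[simp] theorem repr_GX : (basis k).repr (G k * X k) = Finsupp.single 3 1 := by
  simpa [basis] using (basis k).repr_self 3

theorem exists_eq (y : H4 k) : ∃ a b c d : k,
    y = a • (1 : H4 k) + b • G k + c • X k + d • (G k * X k) := by
  refine ⟨(basis k).repr y 0, (basis k).repr y 1, (basis k).repr y 2, (basis k).repr y 3, ?_⟩
  conv_lhs => rw [← (basis k).sum_repr y, Fin.sum_univ_four]
  simp [basis]

theorem comul_linearCombination (a b c d : k) :
    comul (R := k) (a • (1 : H4 k) + b • G k + c • X k + d • (G k * X k)) =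
      a • ((1 : H4 k) ⊗ₜ[k] (1 : H4 k)) + b • (G k ⊗ₜ G k) + c • (X k ⊗ₜ G k + 1 ⊗ₜ X k) +
        d • ((G k * X k) ⊗ₜ 1 + G k ⊗ₜ (G k * X k)) := by
  simp [comul_G, comul_X, mul_add, (rel k).GG, Algebra.TensorProduct.one_def]

/-- The coefficient of a tensor at a pair of basis vectors. -/
def coeff₂ (m n : Fin 4) : H4 k ⊗[k] H4 k →ₗ[k] k :=
  ((basis k).tensorProduct (basis k)).coord (m, n)

@[simp] theorem coeff₂_tmul (m n : Fin 4) (x y : H4 k) :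
    coeff₂ m n (x ⊗ₜ y) = (basis k).repr x m * (basis k).repr y n := by
  simp [coeff₂, Module.Basis.tensorProduct_repr_tmul_apply, mul_comm]

theorem eq_one_or_eq_G {y : H4 k} (hy : IsGroupLikeElem k y) : y = 1 ∨ y = G k := by
  obtain ⟨a, b, c, d, rfl⟩ := exists_eq y
  have hΔ := hy.comul_eq_tmul_self
  rw [comul_linearCombination] at hΔ
  obtain rfl : c = 0 := by simpa using congrArg (coeff₂ 2 2) hΔ
  obtain rfl : d = 0 := by simpa using congrArg (coeff₂ 3 3) hΔ
  have hab : a = 0 ∨ b = 0 := by simpa [or_comm] using congrArg (coeff₂ 0 1) hΔ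
  have hε : a + b = 1 := by simpa using hy.counit_eq_one
  rcases hab with rfl | rfl <;> simp_all

theorem eq_of_comul_eq {y : H4 k} (hy : comul (R := k) y = y ⊗ₜ G k + 1 ⊗ₜ y) :
    y = (basis k).repr y 2 • X k + (basis k).repr y 0 • (1 - G k) := by
  obtain ⟨a, b, c, d, rfl⟩ := exists_eq y
  rw [comul_linearCombination] at hy
  obtain rfl : d = 0 := by simpa using congrArg (coeff₂ 3 0) hy
  have hab : a + b = 0 := by simpa using (congrArg (coeff₂ 0 1) hy).symm
  obtain rfl : b = -a := by linear_combination hab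
  simp
  module

end H4

/-! ### The Kac–Paljutkin Hopf algebra -/

namespace HopfGen

section Relations

variable {k B B' : Type*} [Field k] [Ring B] [Algebra k B] [Ring B'] [Algebra k B']

theorem Rel4.map {G X : B} (R : Rel4 G X) (φ : B →ₐ[k] B') : Rel4 (φ G) (φ X) where
  GG := by rw [← map_mul, R.GG, map_one]
  XX := by rw [← map_mul, R.XX, map_zero]
  XG := by rw [← map_mul, R.XG, map_neg, map_mul]

namespace Rel8

variable {g h z : B} (R : Rel8 k g h z)
include R

theorem map (φ : B →ₐ[k] B') : Rel8 k (φ g) (φ h) (φ z) where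
  gg := by rw [← map_mul, R.gg, map_one]
  hh := by rw [← map_mul, R.hh, map_one]
  gh := by rw [← map_mul, R.gh, map_mul]
  zz := by rw [← map_mul, R.zz]; simp only [map_smul, map_sub, map_add, map_one, map_mul]
  gz := by rw [← map_mul, R.gz, map_mul]
  hz := by rw [← map_mul, R.hz, map_mul]

theorem g_mul_g_mul (a : B) : g * (g * a) = a := by rw [← mul_assoc, R.gg, one_mul]

theorem h_mul_h_mul (a : B) : h * (h * a) = a := by rw [← mul_assoc, R.hh, one_mul]

theorem h_mul_g_mul (a : B) : h * (g * a) = g * (h * a) := by rw [← mul_assoc, ← R.gh, mul_assoc]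

theorem z_mul_g_mul (a : B) : z * (g * a) = h * (z * a) := by rw [← mul_assoc, ← R.hz, mul_assoc]

theorem z_mul_h_mul (a : B) : z * (h * a) = g * (z * a) := by rw [← mul_assoc, ← R.gz, mul_assoc]

theorem neg_z : Rel8 k g h (-z) where
  gg := R.gg
  hh := R.hh
  gh := R.gh
  zz := by rw [neg_mul_neg, R.zz]
  gz := by rw [mul_neg, R.gz, neg_mul]
  hz := by rw [mul_neg, R.hz, neg_mul]

theorem mul_z : Rel8 k g h (g * (h * z)) where
  gg := R.gg
  hh := R.hh
  gh := R.gh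
  zz := by
    simp only [mul_assoc, R.z_mul_g_mul, R.z_mul_h_mul, R.h_mul_g_mul, R.h_mul_h_mul,
      R.g_mul_g_mul, R.zz]
  gz := by simp only [mul_assoc, ← R.gz, R.h_mul_g_mul]
  hz := by simp only [mul_assoc, ← R.hz, R.h_mul_g_mul]

theorem neg_neg_smul {q : k} (hq : q ^ 2 = -1) : Rel8 k (-g) (-h) (q • (g * z)) where
  gg := by rw [neg_mul_neg, R.gg]
  hh := by rw [neg_mul_neg, R.hh]
  gh := by rw [neg_mul_neg, R.gh, neg_mul_neg]
  zz := by
    have gz_sq : g * z * (g * z) = (1 / 2 : k) • (g * h + h + g - 1) := by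
      simp only [mul_assoc, R.z_mul_g_mul, R.zz, mul_smul_comm, mul_sub, mul_add, mul_one, R.hh,
        ← R.gh, R.g_mul_g_mul, R.h_mul_g_mul, R.gg]
    rw [smul_mul_smul_comm, gz_sq, ← sq, hq, neg_smul, one_smul, ← smul_neg, neg_mul_neg]
    congr 1
    abel
  gz := by
    simp only [neg_mul, mul_neg, smul_neg, mul_smul_comm, smul_mul_assoc, mul_assoc, ← R.gz]
  hz := by
    simp only [neg_mul, mul_neg, smul_neg, mul_smul_comm, smul_mul_assoc, mul_assoc, ← R.hz,
      R.h_mul_g_mul]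

end Rel8

section Scalars

variable [CharZero k] {a b c : k} (R : Rel8 k a b c)
include R

theorem Rel8.scalar_ne_zero : c ≠ 0 := by
  rintro rfl
  have zz : 1 + a + b - a * b = 0 := by simpa using R.zz
  have four_eq_zero : (4 : k) = 0 := by
    linear_combination (1 + a + b - a * b) * zz - (1 + b * b - 2 * b) * R.gg -
      (2 - 2 * a) * R.hh
  norm_num at four_eq_zero

theorem Rel8.scalar_eq : b = a :=
  mul_right_cancel₀ R.scalar_ne_zero (by rw [mul_comm, ← R.gz])

theorem Rel8.scalar_sq : c * c = a := by
  have zz := R.zz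
  rw [R.scalar_eq, R.gg, smul_eq_mul] at zz
  linear_combination zz

end Scalars

end Relations

end HopfGen

namespace H8

open HopfAlgebra (antipode)

variable {k : Type*} [Field k]

theorem rel (k : Type*) [Field k] [CharZero k] : HopfGen.Rel8 k (g k) (h k) (z k) := rel8 k

variable [CharZero k]

theorem adjoin_eq_top : Algebra.adjoin k {g k, h k, z k} = ⊤ := by
  refine top_le_iff.1 ((HopfGen.adjoin_ringQuot (Rel k)).symm.le.trans (Algebra.adjoin_mono ?_))
  rintro _ ⟨(_ | _ | _), rfl⟩
  exacts [Or.inl rfl, Or.inr (Or.inl rfl), Or.inr (Or.inr rfl)]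

section Lift

variable {B : Type*} [Ring B] [Algebra k B] {a b c : B} (R : HopfGen.Rel8 k a b c)

/-- The algebra map out of the Kac–Paljutkin algebra given by a triple satisfying its relations. -/
def liftHom : H8 k →ₐ[k] B :=
  lift k (fun | .g => a | .h => b | .z => c) R

@[simp] theorem liftHom_g : liftHom R (g k) = a := lift_gen k _ R .g

@[simp] theorem liftHom_h : liftHom R (h k) = b := lift_gen k _ R .h

@[simp] theorem liftHom_z : liftHom R (z k) = c := lift_gen k _ R .z

theorem hom_ext {φ ψ : H8 k →ₐ[k] B} (hg : φ (g k) = ψ (g k)) (hh : φ (h k) = ψ (h k))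
    (hz : φ (z k) = ψ (z k)) : φ = ψ := by
  refine AlgHom.ext_of_adjoin_eq_top adjoin_eq_top ?_
  rintro _ (rfl | rfl | rfl)
  exacts [hg, hh, hz]

end Lift

@[simp] theorem counit_g : counit (R := k) (g k) = 1 := lift_gen k (counitGen k) (rel8_counit k) .g

@[simp] theorem counit_h : counit (R := k) (h k) = 1 := lift_gen k (counitGen k) (rel8_counit k) .h

@[simp] theorem counit_z : counit (R := k) (z k) = 1 := lift_gen k (counitGen k) (rel8_counit k) .z

theorem isGroupLikeElem_g : IsGroupLikeElem k (g k) :=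
  ⟨counit_g, lift_gen k (comulGen k) (rel8 k).comul .g⟩

theorem isGroupLikeElem_h : IsGroupLikeElem k (h k) :=
  ⟨counit_h, lift_gen k (comulGen k) (rel8 k).comul .h⟩

theorem comul_z_eq : comul (R := k) (z k) = (1 / 2 : k) • (z k ⊗ₜ[k] z k +
    (g k * z k) ⊗ₜ[k] z k + z k ⊗ₜ[k] (h k * z k) - (g k * z k) ⊗ₜ[k] (h k * z k)) := by
  simp only [comul_z, smul_mul_assoc, sub_mul, add_mul, Algebra.TensorProduct.tmul_mul_tmul,
    one_mul]

theorem antipode_iterate_four : (⇑(antipode k (A := H8 k)))^[2 * 2] = id := by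
  have antipode_g : antipode k (g k) = g k :=
    congrArg MulOpposite.unop (lift_gen k (antipodeGen k) (rel8 k).op .g)
  have antipode_h : antipode k (h k) = h k :=
    congrArg MulOpposite.unop (lift_gen k (antipodeGen k) (rel8 k).op .h)
  have antipode_z : antipode k (z k) = z k :=
    congrArg MulOpposite.unop (lift_gen k (antipodeGen k) (rel8 k).op .z)
  refine antipode_iterate_eq_id_of_adjoin adjoin_eq_top ?_
  rintro _ (rfl | rfl | rfl)
  exacts [Function.iterate_fixed antipode_g _, Function.iterate_fixed antipode_h _,
    Function.iterate_fixed antipode_z _]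

/-- A bialgebra map out of the Kac–Paljutkin Hopf algebra, given by the images of the
generators. -/
def liftBialgHom {E : Type*} [Ring E] [Bialgebra k E] {a b c : E} (R : HopfGen.Rel8 k a b c)
    (ha : IsGroupLikeElem k a) (hb : IsGroupLikeElem k b)
    (comul_c : comul (R := k) c = HopfGen.comulZ k a b c) (counit_c : counit (R := k) c = 1) :
    H8 k →ₐc[k] E :=
  BialgHom.ofAlgHom (liftHom R)
    (hom_ext (by simp [ha.counit_eq_one]) (by simp [hb.counit_eq_one]) (by simp [counit_c]))
    (hom_ext (by simp [ha.comul_eq_tmul_self, isGroupLikeElem_g.comul_eq_tmul_self])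
      (by simp [hb.comul_eq_tmul_self, isGroupLikeElem_h.comul_eq_tmul_self])
      (by simp [comul_c, comul_z, HopfGen.comulZ]))

end H8

/-! ### Factorizations through a bialgebra and Sweedler's Hopf algebra -/

section Hits

variable {R C V W : Type*} [CommSemiring R] [AddCommMonoid C] [Module R C] [Coalgebra R C]
  [AddCommMonoid V] [Module R V] [AddCommMonoid W] [Module R W]

/-- The left action `φ ⇀ c = c₁ φ(c₂)` of the functionals on a coalgebra. -/
def leftHit (φ : C →ₗ[R] R) : C →ₗ[R] C := TensorProduct.rid R C ∘ₗ φ.lTensor C ∘ₗ comul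

/-- The right action `c ↼ φ = φ(c₁) c₂` of the functionals on a coalgebra. -/
def rightHit (φ : C →ₗ[R] R) : C →ₗ[R] C := TensorProduct.lid R C ∘ₗ φ.rTensor C ∘ₗ comul

theorem map_smulRight_comul (f : C →ₗ[R] V) (φ : C →ₗ[R] R) (w : W) (c : C) :
    map f (φ.smulRight w) (comul c) = f (leftHit φ c) ⊗ₜ w := by
  have key : map f (φ.smulRight w) = (TensorProduct.mk R V W).flip w ∘ₗ f ∘ₗ
      (TensorProduct.rid R C).toLinearMap ∘ₗ φ.lTensor C := by
    ext; simp [smul_tmul']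
  exact LinearMap.congr_fun key _

theorem map_comul_smulRight (φ : C →ₗ[R] R) (v : V) (f : C →ₗ[R] W) (c : C) :
    map (φ.smulRight v) f (comul c) = v ⊗ₜ f (rightHit φ c) := by
  have key : map (φ.smulRight v) f = TensorProduct.mk R V W v ∘ₗ f ∘ₗ
      (TensorProduct.lid R C).toLinearMap ∘ₗ φ.rTensor C := by
    ext; simp [smul_tmul']
  exact LinearMap.congr_fun key _

@[simp] theorem leftHit_counit (c : C) : leftHit (counit (R := R)) c = c := by simp [leftHit]

@[simp] theorem rightHit_counit (c : C) : rightHit (counit (R := R)) c = c := by simp [rightHit]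

theorem leftHit_of_isGroupLikeElem {c : C} (hc : IsGroupLikeElem R c) (φ : C →ₗ[R] R) :
    leftHit φ c = φ c • c := by simp [leftHit, hc.comul_eq_tmul_self]

theorem rightHit_of_isGroupLikeElem {c : C} (hc : IsGroupLikeElem R c) (φ : C →ₗ[R] R) :
    rightHit φ c = φ c • c := by simp [rightHit, hc.comul_eq_tmul_self]

end Hits

namespace IsFactorization

section Components

variable {R A H E : Type*} [CommSemiring R] [Semiring A] [Bialgebra R A] [Semiring H]
  [Bialgebra R H] [Semiring E] [Bialgebra R E] {i : A →ₐc[R] E} {j : H →ₐc[R] E}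
  (hm : IsFactorization i j)

/-- The operator `h ▷ ·` of the left action of `H` on `A`. -/
def actBy : H →ₗ[R] A →ₗ[R] A := curry (hm.act : H ⊗[R] A →ₗ[R] A)

/-- The operator `h ◁ ·` of the right action of `A` on `H`. -/
def coactBy : H →ₗ[R] A →ₗ[R] H := curry (hm.coact : H ⊗[R] A →ₗ[R] H)

theorem coactBy_apply (h : H) (a : A) : hm.coactBy h a = hm.snd (j h * i a) := rfl

@[simp] theorem actBy_one : hm.actBy 1 = .id := by
  ext a
  change hm.fst (j 1 * i a) = a
  simp

@[simp] theorem coactBy_one : hm.coactBy 1 = (counit (R := R) (A := A)).smulRight 1 := by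
  ext a
  simp [coactBy_apply]

@[simp] theorem coactBy_apply_one (h : H) : hm.coactBy h 1 = h := by simp [coactBy_apply]

theorem coactBy_mul (h : H) (a b : A) :
    hm.coactBy h (a * b) = hm.coactBy (hm.coactBy h a) b := by
  rw [coactBy_apply, map_mul i, ← mul_assoc, snd_mul_eq]
  rfl

theorem map_curry_tmul {P Q : Type*} [AddCommMonoid P] [Module R P] [AddCommMonoid Q] [Module R Q]
    (f : H ⊗[R] A →ₗ[R] P) (g : H ⊗[R] A →ₗ[R] Q) (x y : H) (t : A ⊗[R] A) :
    map f g (AlgebraTensorModule.tensorTensorTensorComm R R R R H H A A ((x ⊗ₜ y) ⊗ₜ t)) =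
      map (curry f x) (curry g y) t := by
  induction t with
  | zero => simp
  | add s t hs ht => rw [tmul_add, map_add, map_add, map_add, hs, ht]
  | tmul a b => simp

theorem mulEquiv_symm_of_isGroupLikeElem {h : H} (hh : IsGroupLikeElem R h) (a : A) :
    hm.mulEquiv.symm (j h * i a) = map (hm.actBy h) (hm.coactBy h) (comul a) := by
  rw [← mulHom_tmul, ← map_act_coact_comul, comul_tmul, hh.comul_eq_tmul_self, map_curry_tmul]
  rfl

theorem comul_coactBy_of_isGroupLikeElem {h : H} (hh : IsGroupLikeElem R h) (a : A) :
    comul (R := R) (hm.coactBy h a) = map (hm.coactBy h) (hm.coactBy h) (comul a) := by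
  change comul (hm.coact (h ⊗ₜ a)) = _
  rw [← CoalgHomClass.map_comp_comul_apply, comul_tmul, hh.comul_eq_tmul_self, map_curry_tmul]
  rfl

theorem counit_coactBy (h : H) (a : A) :
    counit (R := R) (hm.coactBy h a) = counit (R := R) h * counit (R := R) a := by
  change counit (hm.coact (h ⊗ₜ a)) = _
  rw [CoalgHomClass.counit_comp_apply, TensorProduct.counit_tmul, smul_eq_mul, mul_comm]

theorem isGroupLikeElem_coactBy {h : H} (hh : IsGroupLikeElem R h) {a : A}
    (ha : IsGroupLikeElem R a) : IsGroupLikeElem R (hm.coactBy h a) where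
  counit_eq_one := by simp [counit_coactBy, hh.counit_eq_one, ha.counit_eq_one]
  comul_eq_tmul_self := by
    rw [comul_coactBy_of_isGroupLikeElem hm hh, ha.comul_eq_tmul_self, map_tmul]

theorem coactBy_eq_of_adjoin {s : Set A} (hs : Algebra.adjoin R s = ⊤) {h : H}
    (hh : ∀ a ∈ s, hm.coactBy h a = counit (R := R) a • h) :
    hm.coactBy h = (counit (R := R) (A := A)).smulRight h := by
  let W : Submodule R A :=
    LinearMap.eqLocus (hm.coactBy h) ((counit (R := R) (A := A)).smulRight h)
  have hW : W = ⊤ := submodule_eq_top_of_mul_mem hs (by simp [W]) fun a ha b hb => by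
    have hb' : hm.coactBy h b = counit (R := R) b • h := hb
    simp [W, coactBy_mul, hh a ha, hb', smul_smul]
  exact LinearMap.ext fun a => (hW ▸ Submodule.mem_top : a ∈ W)

theorem semiconjBy_of_coactBy_eq {h : H} (hh : IsGroupLikeElem R h)
    (triv : hm.coactBy h = (counit (R := R) (A := A)).smulRight h) (a : A) :
    SemiconjBy (j h) (i a) (i (hm.actBy h a)) := by
  refine EquivLike.injective hm.mulEquiv.symm ?_
  rw [mulEquiv_symm_of_isGroupLikeElem hm hh, triv, map_smulRight_comul, leftHit_counit,
    mulEquiv_symm_mul]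

end Components

section Sweedler

open H4 (G X)

variable {k A E : Type*} [Field k] [Ring A] [Bialgebra k A] [Ring E] [Bialgebra k E]
  {i : A →ₐc[k] E} {j : H4 k →ₐc[k] E} (hm : IsFactorization i j)

theorem coactBy_G_eq_G {a b : A} (ha : IsGroupLikeElem k (hm.coactBy (G k) a))
    (hab : hm.coactBy (G k) (a * b) = G k) : hm.coactBy (G k) a = G k := by
  refine (H4.eq_one_or_eq_G ha).resolve_left fun h1 => ?_
  have : G k = counit (R := k) b • (1 : H4 k) := by simpa [coactBy_mul, h1] using hab.symm
  simpa using congrArg (fun y => (H4.basis k).repr y 1) this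

/-- The coefficient `χ` in `X ◁ a = χ(a) X + ψ(a) (1 - G)`. -/
def coactX : A →ₗ[k] k := (H4.basis k).coord 2 ∘ₗ hm.coactBy (X k)

/-- The coefficient `ψ` in `X ◁ a = χ(a) X + ψ(a) (1 - G)`. -/
def coactOneSubG : A →ₗ[k] k := (H4.basis k).coord 0 ∘ₗ hm.coactBy (X k)

variable (hG : hm.coactBy (G k) = (counit (R := k) (A := A)).smulRight (G k))

include hG

theorem coactBy_X : hm.coactBy (X k) =
    hm.coactX.smulRight (X k) + hm.coactOneSubG.smulRight (1 - G k) := by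
  ext a
  refine H4.eq_of_comul_eq ?_
  change comul (hm.coact (X k ⊗ₜ a)) = _
  rw [← CoalgHomClass.map_comp_comul_apply, comul_tmul, H4.comul_X, add_tmul, map_add, map_add,
    map_curry_tmul, map_curry_tmul]
  change map (hm.coactBy (X k)) (hm.coactBy (G k)) _ + map (hm.coactBy 1) (hm.coactBy (X k)) _ = _
  rw [hG, coactBy_one, map_smulRight_comul, map_comul_smulRight, leftHit_counit, rightHit_counit]

theorem coactBy_X_mul (a b : A) : hm.coactBy (X k) (a * b) =
    (hm.coactX a * hm.coactX b) • X k +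
      (hm.coactX a * hm.coactOneSubG b + hm.coactOneSubG a * counit (R := k) b) • (1 - G k) := by
  rw [coactBy_mul, hm.coactBy_X hG]
  simp only [LinearMap.add_apply, LinearMap.smulRight_apply, map_add, map_smul, map_sub,
    LinearMap.smul_apply, LinearMap.sub_apply, hm.coactBy_X hG, hG, coactBy_one]
  module

/-- The functional `χ` as a character. -/
def coactXHom : A →ₐ[k] k :=
  AlgHom.ofLinearMap hm.coactX (by simp [coactX]) fun a b => by
    simpa [coactX] using congrArg (fun y => (H4.basis k).repr y 2) (hm.coactBy_X_mul hG a b)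

theorem coactOneSubG_mul (a b : A) : hm.coactOneSubG (a * b) =
    hm.coactX a * hm.coactOneSubG b + hm.coactOneSubG a * counit (R := k) b := by
  simpa [coactX, coactOneSubG] using
    congrArg (fun y => (H4.basis k).repr y 0) (hm.coactBy_X_mul hG a b)

theorem coactOneSubG_eq_zero_of_adjoin {s : Set A} (hs : Algebra.adjoin k s = ⊤)
    (h : ∀ a ∈ s, hm.coactOneSubG a = 0) : hm.coactOneSubG = 0 := by
  refine LinearMap.ker_eq_top.1 (submodule_eq_top_of_mul_mem hs ?_ fun a ha b hb => ?_)
  · simp [coactOneSubG]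
  · simp_all [hm.coactOneSubG_mul hG]

theorem mulEquiv_symm_X_mul (a : A) : hm.mulEquiv.symm (j (X k) * i a) =
    hm.actBy (X k) a ⊗ₜ G k + leftHit hm.coactX a ⊗ₜ X k +
      leftHit hm.coactOneSubG a ⊗ₜ (1 - G k) := by
  rw [← mulHom_tmul, ← map_act_coact_comul, comul_tmul, H4.comul_X, add_tmul, map_add, map_add,
    map_curry_tmul, map_curry_tmul]
  change map (hm.actBy (X k)) (hm.coactBy (G k)) _ + map (hm.actBy 1) (hm.coactBy (X k)) _ = _
  simp only [hG, hm.coactBy_X hG, actBy_one, map_add_right, LinearMap.add_apply,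
    map_smulRight_comul, leftHit_counit, LinearMap.id_apply, add_assoc]

theorem comm_mulEquiv_symm_X_mul (a : A) :
    TensorProduct.comm k A (H4 k) (hm.mulEquiv.symm (j (X k) * i a)) =
      X k ⊗ₜ hm.actBy (G k) (rightHit hm.coactX a) +
        (1 - G k) ⊗ₜ hm.actBy (G k) (rightHit hm.coactOneSubG a) + 1 ⊗ₜ hm.actBy (X k) a := by
  rw [← mulHom_tmul, ← map_coact_act_comul, comul_tmul, H4.comul_X, add_tmul, map_add, map_add,
    map_curry_tmul, map_curry_tmul]
  change map (hm.coactBy (X k)) (hm.actBy (G k)) _ + map (hm.coactBy 1) (hm.actBy (X k)) _ = _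
  simp only [hm.coactBy_X hG, coactBy_one, map_add_left, LinearMap.add_apply,
    map_comul_smulRight, rightHit_counit]

/-- The `X`-coefficient of the identity `X² ◁ a = 0`. -/
theorem coactOneSubG_leftHit_add (a : A) :
    hm.coactOneSubG (leftHit hm.coactX a) + hm.coactX (leftHit hm.coactOneSubG a) = 0 := by
  have X_mul : j (X k) * i a = i (hm.actBy (X k) a) * j (G k) +
      i (leftHit hm.coactX a) * j (X k) + i (leftHit hm.coactOneSubG a) * j (1 - G k) := by
    rw [← (EquivLike.injective hm.mulEquiv.symm).eq_iff, mulEquiv_symm_X_mul hm hG]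
    simp only [map_add, mulEquiv_symm_mul]
  have XX_mul : hm.snd (j (X k) * (j (X k) * i a)) = 0 := by
    rw [← mul_assoc, ← map_mul, (H4.rel k).XX, map_zero, zero_mul, map_zero]
  rw [X_mul, mul_add, mul_add, map_add, map_add, ← mul_assoc, ← mul_assoc, ← mul_assoc,
    snd_mul_right, snd_mul_right, snd_mul_right, ← coactBy_apply, ← coactBy_apply,
    ← coactBy_apply, hm.coactBy_X hG] at XX_mul
  have coord_eq := congrArg (fun y => (H4.basis k).repr y 2) XX_mul
  simpa [add_mul, mul_sub, sub_mul, (H4.rel k).XX, (H4.rel k).XG, (H4.rel k).GG] using coord_eq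

variable (hX : hm.coactOneSubG = 0)

include hX

theorem actBy_X_eq_zero_and_leftHit_eq (a : A) : hm.actBy (X k) a = 0 ∧
    leftHit hm.coactX a = hm.actBy (G k) (rightHit hm.coactX a) := by
  have comm_eq := hm.comm_mulEquiv_symm_X_mul hG a
  rw [mulEquiv_symm_X_mul hm hG, hX] at comm_eq
  have coord_eq (m : Fin 4) := congrArg
    (fun t => TensorProduct.lid k A (((H4.basis k).coord m).rTensor A t)) comm_eq
  exact ⟨by simpa [leftHit, rightHit] using (coord_eq 0).symm,
    by simpa [leftHit, rightHit] using coord_eq 2⟩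

theorem semiconjBy_X_of_coactOneSubG_eq_zero (a : A) :
    SemiconjBy (j (X k)) (i a) (i (leftHit hm.coactX a)) := by
  refine EquivLike.injective hm.mulEquiv.symm ?_
  rw [mulEquiv_symm_X_mul hm hG, (hm.actBy_X_eq_zero_and_leftHit_eq hG hX a).1, hX,
    mulEquiv_symm_mul]
  simp [leftHit]

end Sweedler

end IsFactorization

/-! ### Factorizations through the Kac–Paljutkin and Sweedler Hopf algebras -/

namespace H8

variable {k : Type*} [Field k] [CharZero k]

theorem leftHit_z (φ : H8 k →ₗ[k] k) : leftHit φ (z k) =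
    (1 / 2 : k) • (φ (z k) • (z k + g k * z k) + φ (h k * z k) • (z k - g k * z k)) := by
  simp only [leftHit, LinearMap.comp_apply, LinearEquiv.coe_coe, comul_z_eq, map_smul, map_add,
    map_sub, LinearMap.lTensor_tmul, TensorProduct.rid_tmul]
  module

theorem rightHit_z (φ : H8 k →ₗ[k] k) : rightHit φ (z k) =
    (1 / 2 : k) • (φ (z k) • (z k + h k * z k) + φ (g k * z k) • (z k - h k * z k)) := by
  simp only [rightHit, LinearMap.comp_apply, LinearEquiv.coe_coe, comul_z_eq, map_smul, map_add,
    map_sub, LinearMap.rTensor_tmul, TensorProduct.lid_tmul]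
  module

end H8

namespace IsFactorization

open HopfGen (RelA RelB)
open H4 (G X)
open H8 (g h z)

variable {k E : Type*} [Field k] [CharZero k] [Ring E] [Bialgebra k E]
  {i : H8 k →ₐc[k] E} {j : H4 k →ₐc[k] E} (hm : IsFactorization i j)

theorem coactBy_G_g : hm.coactBy (G k) (g k) = G k :=
  hm.coactBy_G_eq_G (b := g k)
    (hm.isGroupLikeElem_coactBy H4.isGroupLikeElem_G H8.isGroupLikeElem_g)
    (by rw [(H8.rel k).gg, coactBy_apply_one])

theorem coactBy_G_h : hm.coactBy (G k) (h k) = G k :=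
  hm.coactBy_G_eq_G (b := h k)
    (hm.isGroupLikeElem_coactBy H4.isGroupLikeElem_G H8.isGroupLikeElem_h)
    (by rw [(H8.rel k).hh, coactBy_apply_one])

theorem coactBy_G_z : hm.coactBy (G k) (z k) = G k := by
  have gz : hm.coactBy (G k) (g k * z k) = hm.coactBy (G k) (z k) := by
    rw [coactBy_mul, coactBy_G_g]
  have hz : hm.coactBy (G k) (h k * z k) = hm.coactBy (G k) (z k) := by
    rw [coactBy_mul, coactBy_G_h]
  have gh : hm.coactBy (G k) (g k * h k) = G k := by rw [coactBy_mul, coactBy_G_g, coactBy_G_h]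
  refine hm.coactBy_G_eq_G (b := z k) ⟨by simp [counit_coactBy], ?_⟩ ?_
  · rw [comul_coactBy_of_isGroupLikeElem hm H4.isGroupLikeElem_G, H8.comul_z_eq]
    simp only [map_smul, map_add, map_sub, map_tmul, gz, hz]
    module
  · rw [(H8.rel k).zz]
    simp only [map_smul, map_add, map_sub, coactBy_apply_one, coactBy_G_g, coactBy_G_h, gh]
    module

theorem coactBy_G : hm.coactBy (G k) = (counit (R := k) (A := H8 k)).smulRight (G k) := by
  refine hm.coactBy_eq_of_adjoin H8.adjoin_eq_top ?_
  rintro _ (rfl | rfl | rfl)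
  · simp [coactBy_G_g]
  · simp [coactBy_G_h]
  · simp [coactBy_G_z]

/-- The character `χ` of the Kac–Paljutkin algebra that determines the factorization. -/
def chi : H8 k →ₐ[k] k := hm.coactXHom hm.coactBy_G

theorem coactX_apply (a : H8 k) : hm.coactX a = hm.chi a := rfl

theorem rel_chi : HopfGen.Rel8 k (hm.chi (g k)) (hm.chi (h k)) (hm.chi (z k)) :=
  (H8.rel k).map hm.chi

theorem chi_h : hm.chi (h k) = hm.chi (g k) := hm.rel_chi.scalar_eq

theorem chi_z_sq : hm.chi (z k) * hm.chi (z k) = hm.chi (g k) := hm.rel_chi.scalar_sq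

theorem leftHit_coactX_z : leftHit hm.coactX (z k) = (hm.chi (z k) / 2) •
    ((1 + hm.chi (g k)) • z k + (1 - hm.chi (g k)) • (g k * z k)) := by
  simp only [H8.leftHit_z, coactX_apply, map_mul, chi_h]
  module

theorem rightHit_coactX_z : rightHit hm.coactX (z k) = (hm.chi (z k) / 2) •
    ((1 + hm.chi (g k)) • z k + (1 - hm.chi (g k)) • (h k * z k)) := by
  simp only [H8.rightHit_z, coactX_apply, map_mul]
  module

theorem coactOneSubG_eq_zero_of_isGroupLikeElem {a : H8 k} (ha : IsGroupLikeElem k a)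
    (hχ : hm.chi a ≠ 0) : hm.coactOneSubG a = 0 := by
  have := hm.coactOneSubG_leftHit_add hm.coactBy_G a
  rw [leftHit_of_isGroupLikeElem ha, leftHit_of_isGroupLikeElem ha, map_smul, map_smul,
    coactX_apply, smul_eq_mul, smul_eq_mul, mul_comm (hm.coactOneSubG a), ← two_mul] at this
  simpa [hχ] using this

theorem chi_g_ne_zero : hm.chi (g k) ≠ 0 := left_ne_zero_of_mul_eq_one hm.rel_chi.gg

theorem chi_h_ne_zero : hm.chi (h k) ≠ 0 := left_ne_zero_of_mul_eq_one hm.rel_chi.hh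

theorem coactOneSubG_g : hm.coactOneSubG (g k) = 0 :=
  hm.coactOneSubG_eq_zero_of_isGroupLikeElem H8.isGroupLikeElem_g hm.chi_g_ne_zero

theorem coactOneSubG_h : hm.coactOneSubG (h k) = 0 :=
  hm.coactOneSubG_eq_zero_of_isGroupLikeElem H8.isGroupLikeElem_h hm.chi_h_ne_zero

theorem coactOneSubG_z : hm.coactOneSubG (z k) = 0 := by
  have gz : hm.coactOneSubG (g k * z k) = hm.chi (g k) * hm.coactOneSubG (z k) := by
    simp [hm.coactOneSubG_mul hm.coactBy_G, coactOneSubG_g, coactX_apply]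
  have hz : hm.coactOneSubG (h k * z k) = hm.chi (g k) * hm.coactOneSubG (z k) := by
    simp [hm.coactOneSubG_mul hm.coactBy_G, coactOneSubG_h, coactX_apply, chi_h]
  have XX_coact := hm.coactOneSubG_leftHit_add hm.coactBy_G (z k)
  rw [leftHit_coactX_z, H8.leftHit_z hm.coactOneSubG, hz] at XX_coact
  simp only [map_smul, map_add, map_sub, gz, coactX_apply, map_mul, smul_eq_mul] at XX_coact
  have : 2 * hm.chi (g k) * hm.chi (z k) * hm.coactOneSubG (z k) = 0 := by
    linear_combination XX_coact +
      hm.chi (z k) * hm.coactOneSubG (z k) * hm.rel_chi.gg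
  simpa [hm.chi_g_ne_zero, hm.rel_chi.scalar_ne_zero] using this

theorem coactOneSubG_eq_zero : hm.coactOneSubG = 0 := by
  refine hm.coactOneSubG_eq_zero_of_adjoin hm.coactBy_G H8.adjoin_eq_top ?_
  rintro _ (rfl | rfl | rfl)
  exacts [hm.coactOneSubG_g, hm.coactOneSubG_h, hm.coactOneSubG_z]

theorem semiconjBy_G (a : H8 k) :
    SemiconjBy (j (G k)) (i (rightHit hm.coactX a)) (i (leftHit hm.coactX a)) := by
  rw [(hm.actBy_X_eq_zero_and_leftHit_eq hm.coactBy_G hm.coactOneSubG_eq_zero a).2]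
  exact hm.semiconjBy_of_coactBy_eq H4.isGroupLikeElem_G hm.coactBy_G _

theorem semiconjBy_X (a : H8 k) :
    SemiconjBy (j (X k)) (i a) (i (leftHit hm.coactX a)) :=
  hm.semiconjBy_X_of_coactOneSubG_eq_zero hm.coactBy_G hm.coactOneSubG_eq_zero a

theorem commute_G_of_isGroupLikeElem {a : H8 k} (ha : IsGroupLikeElem k a)
    (hχ : hm.chi a ≠ 0) : Commute (j (G k)) (i a) := by
  have := hm.semiconjBy_G a
  rw [leftHit_of_isGroupLikeElem ha, rightHit_of_isGroupLikeElem ha, map_smul] at this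
  simpa [Commute, SemiconjBy, hχ, coactX_apply] using this

theorem X_mul_of_isGroupLikeElem {a : H8 k} (ha : IsGroupLikeElem k a) :
    j (X k) * i a = hm.chi a • (i a * j (X k)) := by
  rw [hm.semiconjBy_X a, leftHit_of_isGroupLikeElem ha, map_smul, smul_mul_assoc, coactX_apply]

theorem commute_of_chi_z_eq_one (hχ : hm.chi (z k) = 1) (a : H8 k) (y : H4 k) :
    Commute (i a) (j y) := by
  have chi_g : hm.chi (g k) = 1 := by simpa [hχ] using hm.chi_z_sq.symm
  have chi_eq : hm.chi = Bialgebra.counitAlgHom k (H8 k) :=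
    H8.hom_ext (by simp [chi_g]) (by simp [chi_h, chi_g]) (by simp [hχ])
  have coactX_eq : hm.coactX = counit := congrArg AlgHom.toLinearMap chi_eq
  have G_mul := hm.semiconjBy_G a
  have X_mul := hm.semiconjBy_X a
  rw [coactX_eq, leftHit_counit, rightHit_counit] at G_mul
  rw [coactX_eq, leftHit_counit] at X_mul
  refine semiconjBy_of_adjoin H4.adjoin_eq_top (φ := (j : H4 k →ₐ[k] E))
    (ψ := (j : H4 k →ₐ[k] E)) ?_ y
  rintro _ (rfl | rfl)
  exacts [G_mul.symm, X_mul.symm]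

theorem relA_of_chi_z_eq_neg_one (hχ : hm.chi (z k) = -1) :
    RelA (i (g k)) (i (h k)) (i (z k)) (j (G k)) (j (X k)) := by
  have chi_g : hm.chi (g k) = 1 := by simpa [hχ] using hm.chi_z_sq.symm
  have leftHit_eq : leftHit hm.coactX (z k) = -z k := by
    rw [leftHit_coactX_z, hχ, chi_g]
    module
  have rightHit_eq : rightHit hm.coactX (z k) = -z k := by
    rw [rightHit_coactX_z, hχ, chi_g]
    module
  have G_mul_z := hm.semiconjBy_G (z k)
  have X_mul_z := hm.semiconjBy_X (z k)
  rw [leftHit_eq, rightHit_eq, map_neg, SemiconjBy.neg_right_iff] at G_mul_z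
  rw [leftHit_eq, map_neg] at X_mul_z
  exact {
    gG := (hm.commute_G_of_isGroupLikeElem H8.isGroupLikeElem_g hm.chi_g_ne_zero).symm
    hG := (hm.commute_G_of_isGroupLikeElem H8.isGroupLikeElem_h hm.chi_h_ne_zero).symm
    zG := G_mul_z.symm
    gX := by rw [hm.X_mul_of_isGroupLikeElem H8.isGroupLikeElem_g, chi_g, one_smul]
    hX := by rw [hm.X_mul_of_isGroupLikeElem H8.isGroupLikeElem_h, chi_h, chi_g, one_smul]
    zX := by rw [X_mul_z.eq, neg_mul, neg_neg] }

theorem relB_of_chi_g_eq_neg_one (hχ : hm.chi (g k) = -1) :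
    RelB k (hm.chi (z k)) (i (g k)) (i (h k)) (i (z k)) (j (G k)) (j (X k)) := by
  have leftHit_eq : leftHit hm.coactX (z k) = hm.chi (z k) • (g k * z k) := by
    rw [leftHit_coactX_z, hχ]
    module
  have rightHit_eq : rightHit hm.coactX (z k) = hm.chi (z k) • (h k * z k) := by
    rw [rightHit_coactX_z, hχ]
    module
  have G_mul_hz : j (G k) * i (h k * z k) = i (g k * z k) * j (G k) := by
    have := hm.semiconjBy_G (z k)
    rw [leftHit_eq, rightHit_eq, map_smul, map_smul] at this
    simpa [SemiconjBy, hm.rel_chi.scalar_ne_zero] using this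
  have X_mul_z : j (X k) * i (z k) = hm.chi (z k) • (i (g k * z k) * j (X k)) := by
    rw [hm.semiconjBy_X (z k), leftHit_eq, map_smul, smul_mul_assoc]
  have X_mul_g : j (X k) * i (g k) = -(i (g k) * j (X k)) := by
    rw [hm.X_mul_of_isGroupLikeElem H8.isGroupLikeElem_g, hχ, neg_one_smul]
  have X_mul_h : j (X k) * i (h k) = -(i (h k) * j (X k)) := by
    rw [hm.X_mul_of_isGroupLikeElem H8.isGroupLikeElem_h, chi_h, hχ, neg_one_smul]
  exact {
    gG := (hm.commute_G_of_isGroupLikeElem H8.isGroupLikeElem_g hm.chi_g_ne_zero).symm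
    hG := (hm.commute_G_of_isGroupLikeElem H8.isGroupLikeElem_h hm.chi_h_ne_zero).symm
    gzG := by rw [mul_assoc (j (G k)), ← map_mul, ← map_mul, G_mul_hz]
    gX := by rw [X_mul_g, neg_neg]
    hX := by rw [X_mul_h, neg_neg]
    zX := by
      rw [X_mul_g, neg_mul, mul_assoc, X_mul_z, mul_smul_comm, ← mul_assoc, ← map_mul,
        ← mul_assoc, (H8.rel k).gg, one_mul, smul_neg, smul_smul, chi_z_sq, hχ, neg_one_smul,
        neg_neg] }

end IsFactorization

/-! ### The algebras of dimension 32 -/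

section Twist

variable {R A H E ι : Type*} [CommSemiring R]

/-- The operator `a ⊗ y ↦ σ(a) ⊗ x y` on `A ⊗ H`, by which an element `x` of `H` with
`x a = σ(a) x` acts in a twisted tensor product. -/
def twist [Semiring A] [Algebra R A] [Semiring H] [Algebra R H] (σ : A →ₐ[R] A) (x : H) :
    Module.End R (A ⊗[R] H) :=
  map σ.toLinearMap (LinearMap.mulLeft R x)

/-- The left multiplication by elements of `A` on `A ⊗ H`. -/
def leftMul (R A H : Type*) [CommSemiring R] [Semiring A] [Algebra R A] [AddCommMonoid H]
    [Module R H] : A →ₐ[R] Module.End R (A ⊗[R] H) :=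
  (Module.End.rTensorAlgHom R A H).comp (Algebra.lmul R A)

@[simp] theorem twist_tmul [Semiring A] [Algebra R A] [Semiring H] [Algebra R H] (σ : A →ₐ[R] A)
    (x : H) (a : A) (y : H) : twist σ x (a ⊗ₜ[R] y) = σ a ⊗ₜ (x * y) := rfl

@[simp] theorem leftMul_tmul [Semiring A] [Algebra R A] [AddCommMonoid H] [Module R H] (a b : A)
    (y : H) : leftMul R A H a (b ⊗ₜ[R] y) = (a * b) ⊗ₜ y := rfl

theorem semiconjBy_twist [Semiring A] [Algebra R A] [Semiring H] [Algebra R H] (σ : A →ₐ[R] A)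
    (x : H) (a : A) : SemiconjBy (twist σ x) (leftMul R A H a) (leftMul R A H (σ a)) := by
  ext b y
  simp

variable [Semiring A] [Bialgebra R A] [Semiring H] [Bialgebra R H] [Semiring E] [Bialgebra R E]
  {i : A →ₐc[R] E} {j : H →ₐc[R] E} {x : ι → H}

theorem apply_one_tmul_one_of_twist (hx : Algebra.adjoin R (Set.range x) = ⊤) (σ : ι → A →ₐ[R] A)
    {Ψ : E →ₐ[R] Module.End R (A ⊗[R] H)} (hj : ∀ n, Ψ (j (x n)) = twist (σ n) (x n)) (y : H) :
    Ψ (j y) (1 ⊗ₜ 1) = 1 ⊗ₜ y := by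
  let W : Submodule R H := LinearMap.eqLocus
    (LinearMap.applyₗ (1 ⊗ₜ 1) ∘ₗ Ψ.toLinearMap ∘ₗ (j : H →ₗ[R] E)) (TensorProduct.mk R A H 1)
  have hW : W = ⊤ := by
    refine submodule_eq_top_of_mul_mem hx (by simp [W]) ?_
    rintro _ ⟨n, rfl⟩ w hw
    have hw : Ψ (j w) (1 ⊗ₜ 1) = 1 ⊗ₜ w := hw
    change Ψ (j (x n * w)) (1 ⊗ₜ 1) = 1 ⊗ₜ (x n * w)
    rw [map_mul, map_mul, Module.End.mul_apply, hw, hj, twist_tmul, map_one]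
  exact (hW ▸ Submodule.mem_top : y ∈ W)

/-- A pair of bialgebra maps is a factorization as soon as `E` acts on `A ⊗ H` in the way it has to
act by left multiplication on itself. -/
theorem isFactorization_of_twist (hx : Algebra.adjoin R (Set.range x) = ⊤)
    (hE : Algebra.adjoin R (Set.range i ∪ Set.range (j ∘ x)) = ⊤) (σ : ι → A →ₐ[R] A)
    (hσ : ∀ n a, SemiconjBy (j (x n)) (i a) (i (σ n a)))
    (Ψ : E →ₐ[R] Module.End R (A ⊗[R] H)) (hi : ∀ a, Ψ (i a) = leftMul R A H a)
    (hj : ∀ n, Ψ (j (x n)) = twist (σ n) (x n)) : IsFactorization i j := by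
  refine ⟨?_, ?_⟩
  · have inverse : (LinearMap.applyₗ (1 ⊗ₜ 1) ∘ₗ Ψ.toLinearMap) ∘ₗ
        (mulHom i j : A ⊗[R] H →ₗ[R] E) = .id := by
      ext a y
      simp [hi, apply_one_tmul_one_of_twist hx σ hj]
    exact Function.LeftInverse.injective (g := fun e => Ψ e (1 ⊗ₜ 1))
      (LinearMap.congr_fun inverse)
  · refine LinearMap.range_eq_top.1 (submodule_eq_top_of_mul_mem
      (W := LinearMap.range (mulHom i j : A ⊗[R] H →ₗ[R] E)) hE ⟨1 ⊗ₜ 1, by simp⟩ ?_)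
    rintro e he _ ⟨t, rfl⟩
    induction t with
    | zero => simp
    | add t t' ht ht' => rw [map_add, mul_add]; exact Submodule.add_mem _ ht ht'
    | tmul a y =>
      rcases he with ⟨b, rfl⟩ | ⟨n, rfl⟩
      · exact ⟨(b * a) ⊗ₜ y, by simp [mul_assoc]⟩
      · exact ⟨σ n a ⊗ₜ (x n * y), by simp [← mul_assoc, (hσ n a).eq]⟩

end Twist

section

variable {k A E : Type*} [Field k]

theorem rel4_twist [Ring A] [Algebra k A] {σ τ : A →ₐ[k] A} (hσ : σ.comp σ = .id k A)
    (hστ : σ.comp τ = τ.comp σ) : HopfGen.Rel4 (twist σ (H4.G k)) (twist τ (H4.X k)) := by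
  have hσ (a : A) : σ (σ a) = a := DFunLike.congr_fun hσ a
  have hστ (a : A) : σ (τ a) = τ (σ a) := DFunLike.congr_fun hστ a
  obtain ⟨GG, XX, XG⟩ := H4.rel k
  constructor <;> ext a y : 3
  · simp [← mul_assoc, hσ, GG]
  · simp [← mul_assoc, XX]
  · simp [← mul_assoc, hστ, XG, tmul_neg]

theorem isFactorization_of_twist_G_X [Ring A] [Bialgebra k A] [Ring E] [Bialgebra k E]
    {i : A →ₐc[k] E} {j : H4 k →ₐc[k] E} {s : Set A} (hs : Algebra.adjoin k s = ⊤)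
    (hE : Algebra.adjoin k (i '' s ∪ {j (H4.G k), j (H4.X k)}) = ⊤) (σ τ : A →ₐ[k] A)
    (hσ : ∀ a ∈ s, SemiconjBy (j (H4.G k)) (i a) (i (σ a)))
    (hτ : ∀ a ∈ s, SemiconjBy (j (H4.X k)) (i a) (i (τ a)))
    (Ψ : E →ₐ[k] Module.End k (A ⊗[k] H4 k))
    (hi : ∀ a ∈ s, Ψ (i a) = leftMul k A (H4 k) a)
    (hG : Ψ (j (H4.G k)) = twist σ (H4.G k)) (hX : Ψ (j (H4.X k)) = twist τ (H4.X k)) :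
    IsFactorization i j := by
  refine isFactorization_of_twist (x := ![H4.G k, H4.X k]) ?_ ?_ ![σ, τ] ?_ Ψ ?_ ?_
  · simpa [Set.pair_comm] using H4.adjoin_eq_top (k := k)
  · refine top_le_iff.1 (hE.symm.le.trans (Algebra.adjoin_mono (Set.union_subset_union
      (Set.image_subset_range _ _) ?_)))
    rintro _ (rfl | rfl)
    exacts [⟨0, rfl⟩, ⟨1, rfl⟩]
  · exact Fin.forall_fin_two.2
      ⟨semiconjBy_of_adjoin (φ := AlgHomClass.toAlgHom i) (ψ := (AlgHomClass.toAlgHom i).comp σ)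
          hs hσ,
        semiconjBy_of_adjoin (φ := AlgHomClass.toAlgHom i) (ψ := (AlgHomClass.toAlgHom i).comp τ)
          hs hτ⟩
  · exact DFunLike.congr_fun (AlgHom.ext_of_adjoin_eq_top (φ₁ := Ψ.comp (i : A →ₐ[k] E)) hs hi)
  · exact Fin.forall_fin_two.2 ⟨hG, hX⟩

end

section

variable {k B : Type*} [Field k] [Ring B] [Algebra k B] {g h z G X : B}

theorem relA_iff_semiconjBy : HopfGen.RelA g h z G X ↔
    (SemiconjBy G g g ∧ SemiconjBy G h h ∧ SemiconjBy G z z) ∧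
      SemiconjBy X g g ∧ SemiconjBy X h h ∧ SemiconjBy X z (-z) := by
  constructor
  · rintro ⟨gG, hG, zG, gX, hX, zX⟩
    exact ⟨⟨gG.symm, hG.symm, zG.symm⟩, gX.symm, hX.symm, by rw [SemiconjBy, neg_mul, zX, neg_neg]⟩
  · rintro ⟨⟨Gg, Gh, Gz⟩, Xg, Xh, Xz⟩
    exact ⟨Gg.eq.symm, Gh.eq.symm, Gz.eq.symm, Xg.eq.symm, Xh.eq.symm,
      by rw [Xz.eq, neg_mul, neg_neg]⟩

theorem relB_iff_semiconjBy {q : k} (hq : q ^ 2 = -1) (R : HopfGen.Rel8 k g h z) :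
    HopfGen.RelB k q g h z G X ↔
      (SemiconjBy G g g ∧ SemiconjBy G h h ∧ SemiconjBy G z (g * (h * z))) ∧
        SemiconjBy X g (-g) ∧ SemiconjBy X h (-h) ∧ SemiconjBy X z (q • (g * z)) := by
  have smul_smul_q (x : B) : q • q • x = -x := by rw [smul_smul, ← sq, hq, neg_one_smul]
  constructor
  · rintro ⟨gG, hG, gzG, gX, hX, zX⟩
    refine ⟨⟨gG.symm, hG.symm, ?_⟩, ?_, ?_, ?_⟩
    · calc G * z = h * (G * h * z) := by rw [← hG, mul_assoc h, R.h_mul_h_mul]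
        _ = g * (h * z) * G := by rw [← gzG]; simp only [← mul_assoc, R.gh]
    · rw [SemiconjBy, neg_mul, gX, neg_neg]
    · rw [SemiconjBy, neg_mul, hX, neg_neg]
    · calc X * z = -(g * (X * g * z)) := by
            rw [← neg_eq_iff_eq_neg.2 gX, neg_mul, mul_neg, neg_neg, mul_assoc g, R.g_mul_g_mul]
        _ = q • (g * z) * X := by
            rw [smul_mul_assoc, mul_assoc g, zX, mul_smul_comm, smul_smul_q]
  · rintro ⟨⟨Gg, Gh, Gz⟩, Xg, Xh, Xz⟩
    refine ⟨Gg.eq.symm, Gh.eq.symm, ?_, ?_, ?_, ?_⟩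
    · rw [Gh.eq, mul_assoc h G, Gz.eq]
      simp only [mul_assoc, R.h_mul_g_mul, R.h_mul_h_mul]
    · rw [Xg.eq, neg_mul, neg_neg]
    · rw [Xh.eq, neg_mul, neg_neg]
    · rw [Xg.eq, neg_mul, neg_mul, mul_assoc g, Xz.eq, smul_mul_assoc, mul_smul_comm, smul_neg,
        smul_smul_q, neg_neg, mul_assoc g z, R.g_mul_g_mul]

end

namespace H32A

variable {k : Type*} [Field k] [CharZero k]

theorem adjoin_eq_top : Algebra.adjoin k {g k, h k, z k, G k, X k} = ⊤ := by
  refine top_le_iff.1 ((HopfGen.adjoin_ringQuot (Rel k)).symm.le.trans (Algebra.adjoin_mono ?_))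
  rintro _ ⟨(_ | _ | _ | _ | _), rfl⟩
  exacts [.inl rfl, .inr (.inl rfl), .inr (.inr (.inl rfl)), .inr (.inr (.inr (.inl rfl))),
    .inr (.inr (.inr (.inr rfl)))]

section Lift

variable {B : Type*} [Ring B] [Algebra k B] {a b c d e : B} (R8 : HopfGen.Rel8 k a b c)
  (R4 : HopfGen.Rel4 d e) (RC : HopfGen.RelA a b c d e)

/-- The algebra map out of `H_{32,1}` given by elements satisfying its relations. -/
def liftHom : H32A k →ₐ[k] B :=
  lift k (fun | .g => a | .h => b | .z => c | .G => d | .X => e) R8 R4 RC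

@[simp] theorem liftHom_g : liftHom R8 R4 RC (g k) = a := lift_gen k _ R8 R4 RC .g

@[simp] theorem liftHom_h : liftHom R8 R4 RC (h k) = b := lift_gen k _ R8 R4 RC .h

@[simp] theorem liftHom_z : liftHom R8 R4 RC (z k) = c := lift_gen k _ R8 R4 RC .z

@[simp] theorem liftHom_G : liftHom R8 R4 RC (G k) = d := lift_gen k _ R8 R4 RC .G

@[simp] theorem liftHom_X : liftHom R8 R4 RC (X k) = e := lift_gen k _ R8 R4 RC .X

end Lift

/-- The inclusion of `H8` into `H_{32,1}`. -/
def incl8 (k : Type*) [Field k] [CharZero k] : H8 k →ₐc[k] H32A k :=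
  have comul_gen := lift_gen k (comulGen k) (rel8 k).comul (rel4 k).comul (relC k).comul
  have counit_gen := lift_gen k (counitGen k) (rel8_counit k) (rel4_counit k) (relC_counit k)
  H8.liftBialgHom (a := g k) (b := h k) (c := z k) (rel8 k) ⟨counit_gen .g, comul_gen .g⟩
    ⟨counit_gen .h, comul_gen .h⟩ (comul_z k) (counit_gen .z)

/-- The inclusion of `H4` into `H_{32,1}`. -/
def incl4 (k : Type*) [Field k] [CharZero k] : H4 k →ₐc[k] H32A k :=
  have comul_gen := lift_gen k (comulGen k) (rel8 k).comul (rel4 k).comul (relC k).comul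
  have counit_gen := lift_gen k (counitGen k) (rel8_counit k) (rel4_counit k) (relC_counit k)
  H4.liftBialgHom (a := G k) (b := X k) (rel4 k) ⟨counit_gen .G, comul_gen .G⟩ (comul_gen .X)
    (counit_gen .X)

@[simp] theorem incl8_g : incl8 k (H8.g k) = g k := H8.liftHom_g _

@[simp] theorem incl8_h : incl8 k (H8.h k) = h k := H8.liftHom_h _

@[simp] theorem incl8_z : incl8 k (H8.z k) = z k := H8.liftHom_z _

@[simp] theorem incl4_G : incl4 k (H4.G k) = G k := H4.liftHom_G _

@[simp] theorem incl4_X : incl4 k (H4.X k) = X k := H4.liftHom_X _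

theorem isFactorization : IsFactorization (incl8 k) (incl4 k) := by
  let τ : H8 k →ₐ[k] H8 k := H8.liftHom (H8.rel k).neg_z
  have relC_twist : HopfGen.RelA (leftMul k (H8 k) (H4 k) (H8.g k)) (leftMul k _ _ (H8.h k))
      (leftMul k _ _ (H8.z k)) (twist (.id k _) (H4.G k)) (twist τ (H4.X k)) := by
    have semiconjBy_X := semiconjBy_twist τ (H4.X k)
    exact relA_iff_semiconjBy.2 ⟨⟨semiconjBy_twist _ _ _, semiconjBy_twist _ _ _,
      semiconjBy_twist _ _ _⟩, by simpa [τ] using semiconjBy_X (H8.g k),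
      by simpa [τ] using semiconjBy_X (H8.h k), by simpa [τ] using semiconjBy_X (H8.z k)⟩
  have relC : HopfGen.RelA (g k) (h k) (z k) (G k) (X k) := relC k
  obtain ⟨⟨Gg, Gh, Gz⟩, Xg, Xh, Xz⟩ := relA_iff_semiconjBy.1 relC
  refine isFactorization_of_twist_G_X H8.adjoin_eq_top ?_ (.id k _) τ ?_ ?_
    (liftHom ((H8.rel k).map (leftMul k _ _)) (rel4_twist (σ := .id k _) (τ := τ) rfl rfl)
      relC_twist) ?_ ?_ ?_
  · simpa only [Set.image_insert_eq, Set.image_singleton, Set.insert_union, Set.singleton_union,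
      incl8_g, incl8_h, incl8_z, incl4_G, incl4_X] using adjoin_eq_top
  · simp [Gg, Gh, Gz]
  · simp [Xg, Xh, Xz, τ]
  · simp
  · simp
  · simp

theorem nonempty_bialgEquiv {E : Type*} [Ring E] [Bialgebra k E] {i : H8 k →ₐc[k] E}
    {j : H4 k →ₐc[k] E} (hm : IsFactorization i j)
    (RC : HopfGen.RelA (i (H8.g k)) (i (H8.h k)) (i (H8.z k)) (j (H4.G k)) (j (H4.X k))) :
    Nonempty (E ≃ₐc[k] H32A k) := by
  let f : H32A k →ₐ[k] E := liftHom ((H8.rel k).map (AlgHomClass.toAlgHom i))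
    ((H4.rel k).map (AlgHomClass.toAlgHom j)) RC
  have f_incl8 : f.comp (AlgHomClass.toAlgHom (incl8 k)) = AlgHomClass.toAlgHom i :=
    H8.hom_ext (by simp [f]) (by simp [f]) (by simp [f])
  have f_incl4 : f.comp (AlgHomClass.toAlgHom (incl4 k)) = AlgHomClass.toAlgHom j :=
    H4.hom_ext (by simp [f]) (by simp [f])
  exact (isFactorization.nonempty_bialgEquiv hm f (DFunLike.congr_fun f_incl8)
    (DFunLike.congr_fun f_incl4)).map .symm

end H32A

namespace H32B

variable {k : Type*} [Field k] [CharZero k] {q : k}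

theorem adjoin_eq_top : Algebra.adjoin k {g k q, h k q, z k q, G k q, X k q} = ⊤ := by
  refine top_le_iff.1 ((HopfGen.adjoin_ringQuot (Rel k q)).symm.le.trans (Algebra.adjoin_mono ?_))
  rintro _ ⟨(_ | _ | _ | _ | _), rfl⟩
  exacts [.inl rfl, .inr (.inl rfl), .inr (.inr (.inl rfl)), .inr (.inr (.inr (.inl rfl))),
    .inr (.inr (.inr (.inr rfl)))]

section Lift

variable {B : Type*} [Ring B] [Algebra k B] {a b c d e : B} (R8 : HopfGen.Rel8 k a b c)
  (R4 : HopfGen.Rel4 d e) (RC : HopfGen.RelB k q a b c d e)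

/-- The algebra map out of `H_{32,2}` or `H_{32,3}` given by elements satisfying its relations. -/
def liftHom : H32B k q →ₐ[k] B :=
  lift k q (fun | .g => a | .h => b | .z => c | .G => d | .X => e) R8 R4 RC

@[simp] theorem liftHom_g : liftHom R8 R4 RC (g k q) = a := lift_gen k q _ R8 R4 RC .g

@[simp] theorem liftHom_h : liftHom R8 R4 RC (h k q) = b := lift_gen k q _ R8 R4 RC .h

@[simp] theorem liftHom_z : liftHom R8 R4 RC (z k q) = c := lift_gen k q _ R8 R4 RC .z

@[simp] theorem liftHom_G : liftHom R8 R4 RC (G k q) = d := lift_gen k q _ R8 R4 RC .G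

@[simp] theorem liftHom_X : liftHom R8 R4 RC (X k q) = e := lift_gen k q _ R8 R4 RC .X

end Lift

/-- The inclusion of `H8` into `H_{32,2}` or `H_{32,3}`. -/
def incl8 {k : Type*} [Field k] [CharZero k] (q : k) : H8 k →ₐc[k] H32B k q :=
  have comul_gen := lift_gen k q (comulGen k q) (rel8 k q).comul (rel4 k q).comul
    ((relC k q).comul (rel8 k q))
  have counit_gen := lift_gen k q (counitGen k) (rel8_counit k) (rel4_counit k) (relC_counit k q)
  H8.liftBialgHom (a := g k q) (b := h k q) (c := z k q) (rel8 k q) ⟨counit_gen .g, comul_gen .g⟩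
    ⟨counit_gen .h, comul_gen .h⟩ (comul_z k q) (counit_gen .z)

/-- The inclusion of `H4` into `H_{32,2}` or `H_{32,3}`. -/
def incl4 {k : Type*} [Field k] [CharZero k] (q : k) : H4 k →ₐc[k] H32B k q :=
  have comul_gen := lift_gen k q (comulGen k q) (rel8 k q).comul (rel4 k q).comul
    ((relC k q).comul (rel8 k q))
  have counit_gen := lift_gen k q (counitGen k) (rel8_counit k) (rel4_counit k) (relC_counit k q)
  H4.liftBialgHom (a := G k q) (b := X k q) (rel4 k q) ⟨counit_gen .G, comul_gen .G⟩
    (comul_gen .X) (counit_gen .X)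

@[simp] theorem incl8_g : incl8 q (H8.g k) = g k q := H8.liftHom_g _

@[simp] theorem incl8_h : incl8 q (H8.h k) = h k q := H8.liftHom_h _

@[simp] theorem incl8_z : incl8 q (H8.z k) = z k q := H8.liftHom_z _

@[simp] theorem incl4_G : incl4 q (H4.G k) = G k q := H4.liftHom_G _

@[simp] theorem incl4_X : incl4 q (H4.X k) = X k q := H4.liftHom_X _

theorem isFactorization (hq : q ^ 2 = -1) : IsFactorization (incl8 q) (incl4 q) := by
  have R := H8.rel k
  let σ : H8 k →ₐ[k] H8 k := H8.liftHom R.mul_z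
  let τ : H8 k →ₐ[k] H8 k := H8.liftHom (R.neg_neg_smul hq)
  have σ_σ : σ.comp σ = .id k _ := H8.hom_ext (by simp [σ]) (by simp [σ])
    (by simp [σ, R.h_mul_g_mul, R.h_mul_h_mul, R.g_mul_g_mul])
  have σ_τ : σ.comp τ = τ.comp σ := H8.hom_ext (by simp [σ, τ]) (by simp [σ, τ])
    (by simp [σ, τ, R.h_mul_g_mul])
  have relC_twist : HopfGen.RelB k q (leftMul k (H8 k) (H4 k) (H8.g k)) (leftMul k _ _ (H8.h k))
      (leftMul k _ _ (H8.z k)) (twist σ (H4.G k)) (twist τ (H4.X k)) := by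
    have semiconjBy_G := semiconjBy_twist σ (H4.G k)
    have semiconjBy_X := semiconjBy_twist τ (H4.X k)
    exact (relB_iff_semiconjBy hq (R.map (leftMul k _ _))).2
      ⟨⟨by simpa [σ] using semiconjBy_G (H8.g k), by simpa [σ] using semiconjBy_G (H8.h k),
        by simpa [σ] using semiconjBy_G (H8.z k)⟩, by simpa [τ] using semiconjBy_X (H8.g k),
        by simpa [τ] using semiconjBy_X (H8.h k), by simpa [τ] using semiconjBy_X (H8.z k)⟩
  have R8 : HopfGen.Rel8 k (g k q) (h k q) (z k q) := rel8 k q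
  have relC : HopfGen.RelB k q (g k q) (h k q) (z k q) (G k q) (X k q) := relC k q
  obtain ⟨⟨Gg, Gh, Gz⟩, Xg, Xh, Xz⟩ := (relB_iff_semiconjBy hq R8).1 relC
  refine isFactorization_of_twist_G_X H8.adjoin_eq_top ?_ σ τ ?_ ?_
    (liftHom (R.map (leftMul k _ _)) (rel4_twist σ_σ σ_τ) relC_twist) ?_ ?_ ?_
  · simpa only [Set.image_insert_eq, Set.image_singleton, Set.insert_union, Set.singleton_union,
      incl8_g, incl8_h, incl8_z, incl4_G, incl4_X] using adjoin_eq_top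
  · simp [Gg, Gh, Gz, σ]
  · simp [Xg, Xh, Xz, τ]
  · simp
  · simp
  · simp

theorem nonempty_bialgEquiv (hq : q ^ 2 = -1) {E : Type*} [Ring E] [Bialgebra k E]
    {i : H8 k →ₐc[k] E} {j : H4 k →ₐc[k] E} (hm : IsFactorization i j)
    (RC : HopfGen.RelB k q (i (H8.g k)) (i (H8.h k)) (i (H8.z k)) (j (H4.G k)) (j (H4.X k))) :
    Nonempty (E ≃ₐc[k] H32B k q) := by
  let f : H32B k q →ₐ[k] E := liftHom ((H8.rel k).map (AlgHomClass.toAlgHom i))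
    ((H4.rel k).map (AlgHomClass.toAlgHom j)) RC
  have f_incl8 : f.comp (AlgHomClass.toAlgHom (incl8 q)) = AlgHomClass.toAlgHom i :=
    H8.hom_ext (by simp [f]) (by simp [f]) (by simp [f])
  have f_incl4 : f.comp (AlgHomClass.toAlgHom (incl4 q)) = AlgHomClass.toAlgHom j :=
    H4.hom_ext (by simp [f]) (by simp [f])
  exact ((isFactorization hq).nonempty_bialgEquiv hm f (DFunLike.congr_fun f_incl8)
    (DFunLike.congr_fun f_incl4)).map .symm

end H32B

/-! ### The classification -/

namespace IsFactorization

theorem nonempty_bialgEquiv_tensorProduct {R A H E : Type*} [CommSemiring R] [Semiring A]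
    [Bialgebra R A] [Semiring H] [Bialgebra R H] [Semiring E] [Bialgebra R E] {i : A →ₐc[R] E}
    {j : H →ₐc[R] E} (hm : IsFactorization i j) (comm : ∀ a y, Commute (i a) (j y)) :
    Nonempty (E ≃ₐc[R] A ⊗[R] H) := by
  let f : A ⊗[R] H →ₐ[R] E :=
    Algebra.TensorProduct.lift (AlgHomClass.toAlgHom i) (AlgHomClass.toAlgHom j) comm
  have f_tmul (a : A) (y : H) : f (a ⊗ₜ y) = i a * j y := rfl
  exact (isFactorization_tensorInl_tensorInr.nonempty_bialgEquiv hm f (fun a => by simp [f_tmul])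
    fun y => by simp [f_tmul]).map .symm

theorem exists_bialgEquiv {k E : Type*} [Field k] [CharZero k] {q : k} (hq : q ^ 2 = -1) [Ring E]
    [Bialgebra k E] {i : H8 k →ₐc[k] E} {j : H4 k →ₐc[k] E} (hm : IsFactorization i j) :
    Nonempty (E ≃ₐc[k] (H8 k ⊗[k] H4 k)) ∨ Nonempty (E ≃ₐc[k] H32A k) ∨
      Nonempty (E ≃ₐc[k] H32B k q) ∨ Nonempty (E ≃ₐc[k] H32B k (-q)) := by
  have chi_z_sq := hm.chi_z_sq
  rcases mul_self_eq_one_iff.1 hm.rel_chi.gg with chi_g | chi_g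
  · rw [chi_g, mul_self_eq_one_iff] at chi_z_sq
    rcases chi_z_sq with chi_z | chi_z
    · exact .inl (hm.nonempty_bialgEquiv_tensorProduct (hm.commute_of_chi_z_eq_one chi_z))
    · exact .inr (.inl (H32A.nonempty_bialgEquiv hm (hm.relA_of_chi_z_eq_neg_one chi_z)))
  · have relB := hm.relB_of_chi_g_eq_neg_one chi_g
    rw [chi_g, ← hq, ← sq, sq_eq_sq_iff_eq_or_eq_neg] at chi_z_sq
    rcases chi_z_sq with chi_z | chi_z <;> rw [chi_z] at relB
    · exact .inr (.inr (.inl (H32B.nonempty_bialgEquiv hq hm relB)))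
    · exact .inr (.inr (.inr (H32B.nonempty_bialgEquiv (by rwa [neg_sq]) hm relB)))

end IsFactorization

theorem theorem5p1_general {k : Type*} [Field k] [CharZero k] (i : k) (hi : i ^ 2 = -1)
    {E : Type*} [Ring E] [HopfAlgebra k E] :
    List.TFAE [
      FactorizesThrough k (H8 k) (H4 k) E,
      FactorizesThrough k (H4 k) (H8 k) E,
      IsBicrossedProduct k (H8 k) (H4 k) E,
      IsBicrossedProduct k (H4 k) (H8 k) E,
      Nonempty (E ≃ₐc[k] (H8 k ⊗[k] H4 k)) ∨ Nonempty (E ≃ₐc[k] H32A k) ∨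
        Nonempty (E ≃ₐc[k] H32B k i) ∨ Nonempty (E ≃ₐc[k] H32B k (-i))] := by
  simp only [isBicrossedProduct_iff_factorizesThrough]
  tfae_have 1 → 2 := fun hE => hE.swap two_ne_zero H8.antipode_iterate_four H4.antipode_iterate_four
  tfae_have 2 → 1 := fun hE => hE.swap two_ne_zero H4.antipode_iterate_four H8.antipode_iterate_four
  tfae_have 3 ↔ 1 := Iff.rfl
  tfae_have 4 ↔ 2 := Iff.rfl
  tfae_have 1 → 5 := fun hE =>
    have ⟨_, _, hm⟩ := factorizesThrough_iff.1 hE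
    hm.exists_bialgEquiv hi
  tfae_have 5 → 1 := by
    rintro (⟨⟨e⟩⟩ | ⟨⟨e⟩⟩ | ⟨⟨e⟩⟩ | ⟨⟨e⟩⟩)
    · exact .of_bialgEquiv (factorizesThrough_iff.2 ⟨_, _, isFactorization_tensorInl_tensorInr⟩) e
    · exact .of_bialgEquiv (factorizesThrough_iff.2 ⟨_, _, H32A.isFactorization⟩) e
    · exact .of_bialgEquiv (factorizesThrough_iff.2 ⟨_, _, H32B.isFactorization hi⟩) e
    · exact .of_bialgEquiv
        (factorizesThrough_iff.2 ⟨_, _, H32B.isFactorization (by rwa [neg_sq])⟩) e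
  tfae_finish

end

theorem theorem5p1 {k : Type*} [Field k] [IsAlgClosed k] [CharZero k] (i : k) (hi : i ^ 2 = -1)
    {E : Type*} [Ring E] [HopfAlgebra k E] :
    List.TFAE [
      FactorizesThrough k (H8 k) (H4 k) E,
      FactorizesThrough k (H4 k) (H8 k) E,
      IsBicrossedProduct k (H8 k) (H4 k) E,
      IsBicrossedProduct k (H4 k) (H8 k) E,
      Nonempty (E ≃ₐc[k] (H8 k ⊗[k] H4 k)) ∨ Nonempty (E ≃ₐc[k] H32A k) ∨
        Nonempty (E ≃ₐc[k] H32B k i) ∨ Nonempty (E ≃ₐc[k] H32B k (-i))] :=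
  theorem5p1_general i hi
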